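/- Let $N,k$ be integers with $1\le k\le N$, let $0<p<1$, and put $\omega(x)=\binom Nx p^x(1-p)^{N-x}$ for $x\in\{0,\dots,N\}$. Write ${}_2F_1(u,v;w;z)=\sum_{j\ge0}\frac{(u)_j(v)_j}{(w)_j}\frac{z^j}{j!}$, where $(a)_j=a(a+1)\cdots(a+j-1)$; all series below terminate (terms in which $(u)_j$ or $(v)_j$ vanishes are $0$). Let $P_n(\zeta)=(-N)_n\,p^n\,{}_2F_1(-n,-\zeta;-N;1/p)$, $0\le n\le N$, be the normalized (monic) Krawtchouk polynomials, $\|P_n\|^2_\omega=\sum_{x=0}^N P_n(x)^2\omega(x)$, and let $$K(x,y)=\|P_{k-1}\|_\omega^{-2}\sqrt{\omega(x)\omega(y)}\,\frac{P_k(x)P_{k-1}(y)-P_{k-1}(x)P_k(y)}{x-y}\ (x\ne y),$$ $$K(x,x)=\|P_{k-1}\|_\omega^{-2}\,\omega(x)\bigl(P_k'(x)P_{k-1}(x)-P_{k-1}'(x)P_k(x)\bigr).$$ For $k\le s\le N+1$ let $D_s=\det\bigl(1-K|_{\{s,\dots,N\}\times\{s,\dots,N\}}\bigr)$, so that $D_{N+1}=1$.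 **Theorem.** For $k\le s\le N+1$, $D_s\neq0$ and $D_s$ is the gap probability that a random $k$-point subset $S\subseteq\{0,\dots,N\}$, chosen with probability proportional to $\prod_{x<y,\ x,y\in S}(x-y)^2\prod_{x\in S}\omega(x)$, contains no point of $\{s,\dots,N\}$. Writing $F={}_2F_1$, one has $$D_k=(1-p)^{k(N+1-k)},\qquad D_{k+1}=\binom Nk p^k(1-p)^{k(N-k)}F(-k,-k;-N;1-1/p).$$ Let sequences $e_s,f_s,g_s,h_s$ ($k\le s\le N$) be given by the initial conditions $$e_k=\frac{Np(1-p)^{N-1}(k-1)!^2}{F(1-k,1-k;1-N;1-1/p)},\quad f_k=0,\quad g_k=\frac{k(1-p)}{Np}\cdot\frac{F(1-k,1-k;1-N;1-1/p)}{F(-k,1-k;-N;1-1/p)},\quad h_k=k!,$$ and, for $k\le s<N$, the recurrence relations $$f_{s+1}=N+1-k-f_s+\frac{s}{1+g_s}+\frac{(1-p)(N-s)}{p-1+pg_s},$$ $$g_{s+1}=\frac{(1-p)(f_{s+1}-1-s)(f_{s+1}-1-s+k)}{p\,g_s f_{s+1}(N+1-k-f_{s+1})},$$ $$e_{s+1}=\frac{p\,e_sg_s}{(1-p)g_{s+1}}\cdot\frac{(1+g_{s+1})f_{s+1}+(k-N-1)g_{s+1}-s-1}{\bigl(1+pg_s/(p-1)\bigr)f_{s+1}+k-s-1},$$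 $$h_{s+1}=\frac{(p-1+pg_s)(f_{s+1}-s-1)}{p(N-s)g_s}\,h_s.$$ Then such sequences exist, none of the denominators occurring in these formulas or in the next one vanishes, and for all $k\le s<N$ $$\frac{D_{s+2}}{D_{s+1}}-\frac{D_{s+1}}{D_s}=\binom N{s+1}\frac{p^{s-1}(1-p)^{N-s+1}}{(N-s)^2}\cdot\frac{1+pg_s/(p-1)}{e_sg_s^2}\Bigl[\bigl(1+pg_s/(p-1)\bigr)f_{s+1}-s-1\Bigr]h_s^2.$$ Moreover, the pair $(f_s,g_s)$ is a special case of the difference Painlevé V equation $d$-$P_V$, $$f+\bar f=a_3+\frac{a_1}{1+g}+\frac{a_0}{1+tg},\qquad g\bar g=\frac{(\bar f+a_2-\lambda)(\bar f+a_2-\lambda+a_4)}{t\,\bar f(\bar f-a_3)},\qquad \lambda=a_0+a_1+2a_2+a_3+a_4,$$ in which one step replaces $(a_0,a_1,a_2,a_3,a_4)$ by $(a_0+\lambda,a_1+\lambda,a_2-\lambda,a_3,a_4)$ and fixes $t$: for every $k\le s<N$ the step $(f,g)=(f_s,g_s)\mapsto(\bar f,\bar g)=(f_{s+1},g_{s+1})$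 is the $d$-$P_V$ step with parameters $$a_0=s-N,\quad a_1=s,\quad a_2=-s,\quad a_3=N+1-k,\quad a_4=k,\quad t=\frac p{p-1},\quad\lambda=1,$$ and these parameters at $s+1$ are the image under the step of those at $s$. -/

import Mathlib

/-! Krawtchouk ensemble, its Fredholm determinants, and the difference Painleve V equation. -/

namespace Krawtchouk

/-- The Krawtchouk weight `ω(x) = C(N,x) p^x (1-p)^(N-x)` on `{0, …, N}`. -/
noncomputable def weight (N : ℕ) (p : ℝ) (x : ℕ) : ℝ :=
  (N.choose x : ℝ) * p ^ x * (1 - p) ^ (N - x)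

/-- The Krawtchouk polynomial `K_n(ζ; p, N) = ₂F₁(-n, -ζ; -N; 1/p)` for `n ≤ N`.
The series terminates because of the parameter `-n`. -/
noncomputable def K (N n : ℕ) (p ζ : ℝ) : ℝ :=
  ordinaryHypergeometric (-(n : ℝ)) (-ζ) (-(N : ℝ)) (1 / p)

/-- The normalized (monic) Krawtchouk polynomial `P_n(ζ) = (-N)_n p^n K_n(ζ; p, N)`. -/
noncomputable def P (N n : ℕ) (p ζ : ℝ) : ℝ :=
  (ascPochhammer ℝ n).eval (-(N : ℝ)) * p ^ n * K N n p ζ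

/-- The squared norm `(P_n, P_n)_ω = ∑_{x=0}^N P_n(x)² ω(x)`. -/
noncomputable def normSq (N n : ℕ) (p : ℝ) : ℝ :=
  ∑ x ∈ Finset.range (N + 1), P N n p x ^ 2 * weight N p x

/-- The (symmetrized) Christoffel-Darboux kernel on `{0, …, N}` built from
`P_k` and `P_{k-1}`, for `1 ≤ k ≤ N`. -/
noncomputable def kernel (N k : ℕ) (p : ℝ) (x y : ℕ) : ℝ :=
  if x = y then
    (normSq N (k - 1) p)⁻¹ * weight N p x *
      (deriv (P N k p) x * P N (k - 1) p x - deriv (P N (k - 1) p) x * P N k p x)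
  else
    (normSq N (k - 1) p)⁻¹ * Real.sqrt (weight N p x * weight N p y) *
      ((P N k p x * P N (k - 1) p y - P N (k - 1) p x * P N k p y) / ((x : ℝ) - (y : ℝ)))

/-- `D_s = det (1 - K restricted to {s, …, N})`.
For `s = N + 1` the index set is empty and `D_{N+1} = 1`. -/
noncomputable def D (N k : ℕ) (p : ℝ) (s : ℕ) : ℝ :=
  (1 - Matrix.of fun x y : Finset.Icc s N => kernel N k p x y).det

/-- The unnormalized probability `∏_{x < y in S} (x - y)² ∏_{x ∈ S} ω(x)` of a configuration
`S ⊆ {0, …, N}` in the Krawtchouk ensemble. -/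
noncomputable def configWeight (N : ℕ) (p : ℝ) (S : Finset ℕ) : ℝ :=
  (∏ x ∈ S, ∏ y ∈ S with x < y, ((x : ℝ) - (y : ℝ)) ^ 2) * ∏ x ∈ S, weight N p x

/-- The gap probability: the probability that a random `k`-point configuration in `{0, …, N}`,
with probability proportional to `configWeight`, has no point in `{s, …, N}`. -/
noncomputable def gapProb (N k : ℕ) (p : ℝ) (s : ℕ) : ℝ :=
  (∑ S ∈ (Finset.range (N + 1)).powersetCard k with Disjoint S (Finset.Icc s N),
      configWeight N p S) /
    ∑ S ∈ (Finset.range (N + 1)).powersetCard k, configWeight N p S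

/-- The function `F(u, v; w; z) = ₂F₁(u, v; w; z)`. -/
noncomputable def F (u v w z : ℝ) : ℝ := ordinaryHypergeometric u v w z

/-- The sequences `e, f, g, h` have the prescribed initial values at `k` and satisfy the
recurrence relations for every step `s → s + 1` with `k ≤ s < N`. -/
structure IsSolution (N k : ℕ) (p : ℝ) (e f g h : ℕ → ℝ) : Prop where
  e_init : e k = N * p * (1 - p) ^ (N - 1) * ((k - 1).factorial : ℝ) ^ 2 /
    F (1 - k) (1 - k) (1 - N) (1 - 1 / p)
  f_init : f k = 0
  g_init : g k = k * (1 - p) / (N * p) *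
    (F (1 - k) (1 - k) (1 - N) (1 - 1 / p) / F (-k) (1 - k) (-N) (1 - 1 / p))
  h_init : h k = (k.factorial : ℝ)
  e_step : ∀ s, k ≤ s → s < N →
    e (s + 1) = p * e s * g s / ((1 - p) * g (s + 1)) *
      (((1 + g (s + 1)) * f (s + 1) + ((k : ℝ) - N - 1) * g (s + 1) - s - 1) /
        ((1 + p * g s / (p - 1)) * f (s + 1) + k - s - 1))
  f_step : ∀ s, k ≤ s → s < N →
    f (s + 1) = (N : ℝ) + 1 - k - f s + s / (1 + g s) +
      (1 - p) * ((N : ℝ) - s) / (p - 1 + p * g s)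
  g_step : ∀ s, k ≤ s → s < N →
    g (s + 1) = (1 - p) * (f (s + 1) - 1 - s) * (f (s + 1) - 1 - s + k) /
      (p * g s * f (s + 1) * ((N : ℝ) + 1 - k - f (s + 1)))
  h_step : ∀ s, k ≤ s → s < N →
    h (s + 1) = (p - 1 + p * g s) * (f (s + 1) - s - 1) / (p * ((N : ℝ) - s) * g s) * h s

end Krawtchouk

/-- Parameters of the difference Painleve V equation: the root variables `a₀, …, a₄` of type
`D₄⁽¹⁾` and the constant `t`. -/
@[ext]
structure DPVParams where
  a0 : ℝ
  a1 : ℝ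
  a2 : ℝ
  a3 : ℝ
  a4 : ℝ
  t : ℝ

namespace DPVParams

/-- `λ = a₀ + a₁ + 2 a₂ + a₃ + a₄`. -/
def lam (A : DPVParams) : ℝ := A.a0 + A.a1 + 2 * A.a2 + A.a3 + A.a4

/-- The action of one step of d-P_V on the parameters:
`(a₀, a₁, a₂, a₃, a₄) ↦ (a₀ + λ, a₁ + λ, a₂ - λ, a₃, a₄)`. -/
def shift (A : DPVParams) : DPVParams where
  a0 := A.a0 + A.lam
  a1 := A.a1 + A.lam
  a2 := A.a2 - A.lam
  a3 := A.a3
  a4 := A.a4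
  t := A.t

/-- `(f, g) ↦ (f', g')` is one step of d-P_V with parameters `A`, all denominators being nonzero:
`f + f' = a₃ + a₁/(1+g) + a₀/(1+tg)`,
`g g' = (f'+a₂-λ)(f'+a₂-λ+a₄) / (t f' (f'-a₃))`. -/
def IsStep (A : DPVParams) (f g f' g' : ℝ) : Prop :=
  1 + g ≠ 0 ∧ 1 + A.t * g ≠ 0 ∧ A.t ≠ 0 ∧ f' ≠ 0 ∧ f' - A.a3 ≠ 0 ∧
  f + f' = A.a3 + A.a1 / (1 + g) + A.a0 / (1 + A.t * g) ∧
  g * g' = (f' + A.a2 - A.lam) * (f' + A.a2 - A.lam + A.a4) / (A.t * f' * (f' - A.a3))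

end DPVParams

/-- The d-P_V parameters of the step `s → s + 1` in the Krawtchouk case. -/
noncomputable def Krawtchouk.dpvParams (N k : ℕ) (p : ℝ) (s : ℕ) : DPVParams where
  a0 := (s : ℝ) - N
  a1 := s
  a2 := -s
  a3 := (N : ℝ) + 1 - k
  a4 := k
  t := p / (p - 1)

/-! Let `u_s` be the monic orthogonal polynomial of degree `k` for `ω` restricted to `{0, …, s-1}`,
let `v_s` be that of degree `k-1` divided by its squared norm, and let `κ_s` be the reproducing
kernel of the polynomials of degree `< k`. With `G_s` the Hankel moment matrix of the restricted
weight, expansion over configurations gives the gap probability as `det G_s / det G_{N+1}`, and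
Sylvester's determinant identity gives the same value for `D_s` (`gapProb_eq_div`, `D_eq_div`).
Hence `D_{s+1}/D_s = ρ_s := 1 + ω(s) κ_s(s,s)`, and the recurrence for `D` concerns `ρ_{s+1} - ρ_s`.

Two mechanisms connect levels `s` and `s+1`. Adding the node `s` is a rank-one perturbation, which
Christoffel–Darboux expresses through `α_s = u_s(s)` and `β_s = v_s(s)`. The Pearson equation of `ω`
writes `x (u_s(x-1), v_s(x-1))` as a 2×2 matrix, affine in `x`, applied to `(u_{s+1}(x),
v_{s+1}(x))` (`orthoPoly_ladder`, `leadDual_ladder`). At `x = 0` the left side vanishes, so the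
values at `0` span the kernel of the matrix; the single number `e_s = -u_{s+1}(0)/v_{s+1}(0)`,
together with the drop `T_s` of the subleading coefficient, then fixes the off-diagonal entries. At
`x = s+1` the matrix relates `α_s, β_s` to `α_{s+1}, β_{s+1}`. Together with the rank-one update of
the norms and of the values at `0`, this is a closed scalar system (`ladderStep`), and in the
coordinates `g = α/(βe)`, `f = s/(1+g) - T`, `h = α` it becomes the stated recurrences by
elimination.

The orthogonal polynomials have no zeros to the right of their nodes, which makes `α, β, T, e, g`
positive; all nonvanishing claims follow from this. At `s = k` there are only `k` nodes, so
interpolation gives the initial values in closed form. Since the recurrences determine the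
sequences, everything transfers to an arbitrary solution (`IsSolution.unique`). -/

section

open Polynomial Finset

/-! ### The moment functional of a truncated weight and the polynomials dual to functionals. -/

namespace TruncatedWeight

variable {w : ℕ → ℝ} {s k : ℕ}

/-- The linear functional `q ↦ ∑_{x < s} w(x) q(x)`. -/
noncomputable def pairing (w : ℕ → ℝ) (s : ℕ) : ℝ[X] →ₗ[ℝ] ℝ :=
  ∑ x ∈ range s, w x • leval (x : ℝ)

lemma pairing_apply (w : ℕ → ℝ) (s : ℕ) (q : ℝ[X]) :
    pairing w s q = ∑ x ∈ range s, w x * q.eval (x : ℝ) := by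
  simp [pairing, LinearMap.sum_apply]

lemma pairing_succ (w : ℕ → ℝ) (s : ℕ) (q : ℝ[X]) :
    pairing w (s + 1) q = pairing w s q + w s * q.eval (s : ℝ) := by
  simp [pairing_apply, sum_range_succ]

lemma pairing_C_mul (w : ℕ → ℝ) (s : ℕ) (c : ℝ) (q : ℝ[X]) :
    pairing w s (C c * q) = c * pairing w s q := by
  rw [← smul_eq_C_mul, map_smul, smul_eq_mul]

lemma eq_zero_of_eval_eq_zero {q : ℝ[X]} (hks : k ≤ s) (hq : q.degree < k)
    (h : ∀ x < s, q.eval (x : ℝ) = 0) : q = 0 := by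
  refine eq_zero_of_degree_lt_of_eval_finset_eq_zero
    ((range s).map ⟨fun x : ℕ => (x : ℝ), Nat.cast_injective⟩) ?_ ?_
  · rw [card_map, card_range]
    exact hq.trans_le (by exact_mod_cast hks)
  · simpa using h

lemma pairing_self_nonneg (hw : ∀ x < s, 0 < w x) (q : ℝ[X]) : 0 ≤ pairing w s (q * q) := by
  rw [pairing_apply]
  refine sum_nonneg fun x hx => mul_nonneg (hw x (mem_range.1 hx)).le ?_
  rw [eval_mul]
  exact mul_self_nonneg _

lemma eval_eq_zero_of_pairing_self (hw : ∀ x < s, 0 < w x) {q : ℝ[X]}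
    (h : pairing w s (q * q) = 0) : ∀ x < s, q.eval (x : ℝ) = 0 := by
  intro x hx
  rw [pairing_apply, sum_eq_zero_iff_of_nonneg] at h
  · have := h x (mem_range.2 hx)
    simpa [(hw x hx).ne'] using this
  · intro y hy
    rw [eval_mul]
    exact mul_nonneg (hw y (mem_range.1 hy)).le (mul_self_nonneg _)

lemma eq_zero_of_pairing_self (hw : ∀ x < s, 0 < w x) (hks : k ≤ s) {q : ℝ[X]}
    (hq : q.degree < k) (h : pairing w s (q * q) = 0) : q = 0 :=
  eq_zero_of_eval_eq_zero hks hq (eval_eq_zero_of_pairing_self hw h)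

lemma ext_of_pairing (hw : ∀ x < s, 0 < w x) (hks : k ≤ s) {q r : ℝ[X]}
    (hq : q.degree < k) (hr : r.degree < k)
    (h : ∀ m : ℝ[X], m.degree < k → pairing w s (q * m) = pairing w s (r * m)) : q = r := by
  have hqr : (q - r).degree < k := (degree_sub_le _ _).trans_lt (max_lt hq hr)
  refine sub_eq_zero.1 (eq_zero_of_pairing_self hw hks hqr ?_)
  rw [sub_mul, map_sub, h _ hqr, sub_self]

/-- The Hankel matrix of moments of the weight `w` restricted to `{0, …, s - 1}`. -/
noncomputable def momentMatrix (w : ℕ → ℝ) (s k : ℕ) : Matrix (Fin k) (Fin k) ℝ :=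
  Matrix.of fun i j => pairing w s (X ^ (i : ℕ) * X ^ (j : ℕ))

/-- The polynomial with coefficient vector `a`. -/
noncomputable def ofCoeffs (a : Fin k → ℝ) : ℝ[X] := ∑ i, C (a i) * X ^ (i : ℕ)

lemma degree_ofCoeffs_lt (a : Fin k → ℝ) : (ofCoeffs a).degree < k := by
  refine (degree_sum_le _ _).trans_lt ((Finset.sup_lt_iff (WithBot.bot_lt_coe k)).2 fun i _ => ?_)
  exact (degree_C_mul_X_pow_le _ _).trans_lt (Nat.cast_lt.2 i.2)

lemma coeff_ofCoeffs (a : Fin k → ℝ) (i : Fin k) : (ofCoeffs a).coeff i = a i := by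
  simp [ofCoeffs, coeff_X_pow, Fin.val_inj]

lemma ofCoeffs_coeff {q : ℝ[X]} (hq : q.degree < k) :
    ofCoeffs (fun i : Fin k => q.coeff i) = q := by
  rw [ofCoeffs, Fin.sum_univ_eq_sum_range (fun i => C (q.coeff i) * X ^ i) k]
  rcases eq_or_ne q 0 with rfl | h0
  · simp
  · exact (as_sum_range_C_mul_X_pow' _ ((natDegree_lt_iff_degree_lt h0).2 hq)).symm

lemma pairing_ofCoeffs_mul_X_pow (a : Fin k → ℝ) (j : Fin k) :
    pairing w s (ofCoeffs a * X ^ (j : ℕ)) = (momentMatrix w s k).mulVec a j := by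
  simp only [ofCoeffs, sum_mul, map_sum, Matrix.mulVec, dotProduct, momentMatrix, Matrix.of_apply,
    mul_assoc, pairing_C_mul]
  exact sum_congr rfl fun i _ => by rw [mul_comm, mul_comm (X ^ (j : ℕ))]

lemma linearMap_ext_ofCoeffs (φ : ℝ[X] →ₗ[ℝ] ℝ) (a : Fin k → ℝ) :
    φ (ofCoeffs a) = ∑ i, a i * φ (X ^ (i : ℕ)) := by
  simp [ofCoeffs, ← smul_eq_C_mul]

/-- A kernel vector is the coefficient vector of some `q` of degree `< k` with `⟨q, q⟩ = 0`; such a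
`q` vanishes on `s ≥ k` nodes. -/
lemma det_momentMatrix_ne_zero (hw : ∀ x < s, 0 < w x) (hks : k ≤ s) :
    (momentMatrix w s k).det ≠ 0 := by
  intro h
  obtain ⟨a, ha, h0⟩ := Matrix.exists_mulVec_eq_zero_iff.2 h
  refine ha (funext fun i => ?_)
  have hz : ofCoeffs a = 0 := by
    refine eq_zero_of_pairing_self hw hks (degree_ofCoeffs_lt a) ?_
    have := linearMap_ext_ofCoeffs ((pairing w s).comp (LinearMap.mulLeft ℝ (ofCoeffs a))) a
    simp only [LinearMap.comp_apply, LinearMap.mulLeft_apply, pairing_ofCoeffs_mul_X_pow, h0] at this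
    simpa using this
  rw [← coeff_ofCoeffs a i, hz]
  simp

/-- The polynomial of degree `< k` representing the functional `φ` with respect to `pairing`. -/
noncomputable def dualPoly (w : ℕ → ℝ) (s k : ℕ) (φ : ℝ[X] →ₗ[ℝ] ℝ) : ℝ[X] :=
  ofCoeffs ((momentMatrix w s k)⁻¹.mulVec fun j => φ (X ^ (j : ℕ)))

lemma degree_dualPoly_lt (φ : ℝ[X] →ₗ[ℝ] ℝ) : (dualPoly w s k φ).degree < k :=
  degree_ofCoeffs_lt _

/-- Riesz representation. It is applied to three functionals: pairing with `X ^ k`, the top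
coefficient, and evaluation at a point. -/
lemma pairing_dualPoly_mul (hw : ∀ x < s, 0 < w x) (hks : k ≤ s) (φ : ℝ[X] →ₗ[ℝ] ℝ) {q : ℝ[X]}
    (hq : q.degree < k) : pairing w s (dualPoly w s k φ * q) = φ q := by
  have hdet : IsUnit (momentMatrix w s k).det := (det_momentMatrix_ne_zero hw hks).isUnit
  rw [← ofCoeffs_coeff hq, linearMap_ext_ofCoeffs φ]
  have := linearMap_ext_ofCoeffs ((pairing w s).comp (LinearMap.mulLeft ℝ (dualPoly w s k φ)))
    (fun i : Fin k => q.coeff i)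
  simp only [LinearMap.comp_apply, LinearMap.mulLeft_apply, dualPoly, pairing_ofCoeffs_mul_X_pow,
    Matrix.mulVec_mulVec, Matrix.mul_nonsing_inv _ hdet, Matrix.one_mulVec] at this
  exact this

lemma eq_dualPoly (hw : ∀ x < s, 0 < w x) (hks : k ≤ s) (φ : ℝ[X] →ₗ[ℝ] ℝ) {r : ℝ[X]}
    (hr : r.degree < k) (h : ∀ q : ℝ[X], q.degree < k → pairing w s (r * q) = φ q) :
    r = dualPoly w s k φ :=
  ext_of_pairing hw hks hr (degree_dualPoly_lt φ) fun m hm => by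
    rw [h m hm, pairing_dualPoly_mul hw hks φ hm]

end TruncatedWeight

end

/-! ### Orthogonal polynomials, the reproducing kernel and Christoffel–Darboux. -/

section

open Polynomial Finset

namespace TruncatedWeight

variable {w : ℕ → ℝ} {s k n : ℕ}

/-- The polynomial `q` has degree less than `n`. -/
abbrev DegLT (q : ℝ[X]) (n : ℕ) : Prop := q.degree < n

lemma degLT_iff {q : ℝ[X]} : DegLT q n ↔ ∀ m, n ≤ m → q.coeff m = 0 :=
  degree_lt_iff_coeff_zero _ _

lemma degLT_neg {q : ℝ[X]} : DegLT (-q) n ↔ DegLT q n := by simp [degLT_iff]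

lemma degree_X_mul_lt {q : ℝ[X]} (hq : DegLT q n) : DegLT (X * q) (n + 1) := by
  rw [degLT_iff] at hq ⊢
  intro m hm
  obtain ⟨m, rfl⟩ : ∃ l, m = l + 1 := ⟨m - 1, by omega⟩
  rw [coeff_X_mul]
  exact hq m (by omega)

lemma degree_C_mul_lt {q : ℝ[X]} (c : ℝ) (hq : DegLT q n) : DegLT (C c * q) n := by
  rw [degLT_iff] at hq ⊢
  intro m hm
  rw [coeff_C_mul, hq m hm, mul_zero]

lemma degree_lt_succ {q : ℝ[X]} (hq : DegLT q n) : DegLT q (n + 1) :=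
  hq.trans (by exact_mod_cast Nat.lt_succ_self n)

lemma degree_sub_lt' {q r : ℝ[X]} (hq : DegLT q n) (hr : DegLT r n) :
    DegLT (q - r) n :=
  (degree_sub_le _ _).trans_lt (max_lt hq hr)

lemma degree_add_lt' {q r : ℝ[X]} (hq : DegLT q n) (hr : DegLT r n) :
    DegLT (q + r) n :=
  (degree_add_le _ _).trans_lt (max_lt hq hr)

lemma degree_X_sub_C_mul_lt {q : ℝ[X]} (y : ℝ) (hq : DegLT q n) :
    DegLT ((X - C y) * q) (n + 1) := by
  rw [sub_mul]
  exact degree_sub_lt' (degree_X_mul_lt hq) (degree_lt_succ (degree_C_mul_lt y hq))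

lemma degree_lt_of_succ {q : ℝ[X]} (hq : DegLT q (n + 1)) (h0 : q.coeff n = 0) :
    DegLT q n := by
  rw [degLT_iff] at hq ⊢
  intro m hm
  rcases hm.eq_or_lt with rfl | hm
  · exact h0
  · exact hq m hm

lemma degree_sub_leading_lt {q : ℝ[X]} (hq : DegLT q (n + 1)) :
    DegLT (q - C (q.coeff n) * X ^ n) n := by
  refine degree_lt_of_succ (degree_sub_lt' hq ?_) (by simp)
  exact (degree_C_mul_X_pow_le _ _).trans_lt (Nat.cast_lt.2 n.lt_succ_self)

/-- The monic orthogonal polynomial of degree `k` for the weight `w` on `{0, …, s - 1}`. -/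
noncomputable def orthoPoly (w : ℕ → ℝ) (s k : ℕ) : ℝ[X] :=
  X ^ k - dualPoly w s k ((pairing w s).comp (LinearMap.mulLeft ℝ (X ^ k)))

/-- The orthogonal polynomial of degree `n` divided by its squared norm. It represents the
functional `q ↦ q.coeff n` on polynomials of degree at most `n`. -/
noncomputable def leadDual (w : ℕ → ℝ) (s n : ℕ) : ℝ[X] := dualPoly w s (n + 1) (lcoeff ℝ n)

/-- The reproducing kernel of polynomials of degree `< k`, as a polynomial in one variable. -/
noncomputable def reproKernel (w : ℕ → ℝ) (s k : ℕ) (y : ℝ) : ℝ[X] := dualPoly w s k (leval y)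

lemma degree_orthoPoly_sub_lt (w : ℕ → ℝ) (s k : ℕ) : DegLT (orthoPoly w s k - X ^ k) k := by
  rw [orthoPoly, sub_sub_cancel_left, degLT_neg]
  exact degree_dualPoly_lt _

lemma degree_orthoPoly_lt (w : ℕ → ℝ) (s k : ℕ) : DegLT (orthoPoly w s k) (k + 1) := by
  rw [← sub_add_cancel (orthoPoly w s k) (X ^ k)]
  exact degree_add_lt' (degree_lt_succ (degree_orthoPoly_sub_lt w s k))
    ((degree_X_pow_le _).trans_lt (Nat.cast_lt.2 k.lt_succ_self))

lemma coeff_orthoPoly_self (w : ℕ → ℝ) (s k : ℕ) : (orthoPoly w s k).coeff k = 1 := by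
  have := (degree_lt_iff_coeff_zero _ _).1 (degree_orthoPoly_sub_lt w s k) k le_rfl
  rw [coeff_sub, coeff_X_pow_self] at this
  linarith

lemma pairing_orthoPoly_mul (hw : ∀ x < s, 0 < w x) (hks : k ≤ s) {q : ℝ[X]} (hq : DegLT q k) :
    pairing w s (orthoPoly w s k * q) = 0 := by
  rw [orthoPoly, sub_mul, map_sub, pairing_dualPoly_mul hw hks _ hq]
  simp

lemma eq_orthoPoly (hw : ∀ x < s, 0 < w x) (hks : k ≤ s) {r : ℝ[X]}
    (hr : DegLT (r - X ^ k) k)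
    (h : ∀ q : ℝ[X], DegLT q k → pairing w s (r * q) = 0) : r = orthoPoly w s k := by
  have h1 : X ^ k - r = dualPoly w s k ((pairing w s).comp (LinearMap.mulLeft ℝ (X ^ k))) := by
    refine eq_dualPoly hw hks _ (degLT_neg.1 (by rwa [neg_sub])) fun q hq => ?_
    rw [sub_mul, map_sub, h q hq]
    simp
  rw [orthoPoly, ← h1, sub_sub_cancel]

lemma degree_leadDual_lt (w : ℕ → ℝ) (s n : ℕ) : DegLT (leadDual w s n) (n + 1) :=
  degree_dualPoly_lt _

lemma pairing_leadDual_mul (hw : ∀ x < s, 0 < w x) (hks : n + 1 ≤ s) {q : ℝ[X]}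
    (hq : DegLT q (n + 1)) : pairing w s (leadDual w s n * q) = q.coeff n :=
  pairing_dualPoly_mul hw hks _ hq

lemma degree_reproKernel_lt (w : ℕ → ℝ) (s k : ℕ) (y : ℝ) : DegLT (reproKernel w s k y) k :=
  degree_dualPoly_lt _

lemma pairing_reproKernel_mul (hw : ∀ x < s, 0 < w x) (hks : k ≤ s) (y : ℝ) {q : ℝ[X]}
    (hq : DegLT q k) : pairing w s (reproKernel w s k y * q) = q.eval y :=
  pairing_dualPoly_mul hw hks _ hq

/-- Both sides are the pairing of the kernel with `leadDual`, read once through each representing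
property. -/
lemma coeff_reproKernel (hw : ∀ x < s, 0 < w x) (hks : n + 1 ≤ s) (y : ℝ) :
    (reproKernel w s (n + 1) y).coeff n = (leadDual w s n).eval y := by
  rw [← pairing_leadDual_mul hw hks (degree_reproKernel_lt w s (n + 1) y), mul_comm,
    pairing_reproKernel_mul hw hks y (degree_leadDual_lt w s n)]

lemma reproKernel_self_nonneg (hw : ∀ x < s, 0 < w x) (hks : k ≤ s) (y : ℝ) :
    0 ≤ (reproKernel w s k y).eval y := by
  rw [← pairing_reproKernel_mul hw hks y (degree_reproKernel_lt w s k y)]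
  exact pairing_self_nonneg hw _

/-- A polynomial of degree at most `n` orthogonal to all polynomials of degree less than `n` is a
multiple of the orthogonal polynomial of degree `n`. -/
lemma eq_C_mul_leadDual (hw : ∀ x < s, 0 < w x) (hks : n + 1 ≤ s) {r g : ℝ[X]}
    (hr : DegLT r (n + 1)) (h : ∀ q : ℝ[X], DegLT q n → pairing w s (r * q) = 0)
    (hg : DegLT (g - X ^ n) n) :
    r = C (pairing w s (r * g)) * leadDual w s n := by
  refine ext_of_pairing hw hks hr (degree_C_mul_lt _ (degree_leadDual_lt w s n)) fun m hm => ?_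
  have hm' : DegLT (m - C (m.coeff n) * g) n := by
    have : m - C (m.coeff n) * g =
        m - C (m.coeff n) * X ^ n - C (m.coeff n) * (g - X ^ n) := by ring
    rw [this]
    exact degree_sub_lt' (degree_sub_leading_lt hm) (degree_C_mul_lt _ hg)
  have h1 := h _ hm'
  rw [mul_sub, map_sub, mul_left_comm, pairing_C_mul] at h1
  rw [mul_assoc, pairing_C_mul, pairing_leadDual_mul hw hks hm]
  linarith

/-- The Christoffel-Darboux formula. -/
lemma christoffel_darboux (hw : ∀ x < s, 0 < w x) (hks : n + 1 ≤ s) (y : ℝ) :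
    (X - C y) * reproKernel w s (n + 1) y =
      C ((leadDual w s n).eval y) * orthoPoly w s (n + 1) -
        C ((orthoPoly w s (n + 1)).eval y) * leadDual w s n := by
  set κ := reproKernel w s (n + 1) y with hκ
  set v := leadDual w s n
  set u := orthoPoly w s (n + 1) with hu
  have hκd : DegLT κ (n + 1) := degree_reproKernel_lt w s (n + 1) y
  -- The terms of degree `n + 1` cancel because the top coefficient of `κ` is `v(y)`.
  have hd : DegLT ((X - C y) * κ - C (v.eval y) * u) (n + 1) := by
    refine degree_lt_of_succ (degree_sub_lt' (degree_X_sub_C_mul_lt y hκd)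
      (degree_C_mul_lt _ (degree_orthoPoly_lt w s (n + 1)))) ?_
    rw [coeff_sub, coeff_C_mul, hu, coeff_orthoPoly_self, sub_mul, coeff_sub, coeff_X_mul, coeff_C_mul,
      (degree_lt_iff_coeff_zero _ _).1 hκd _ le_rfl, hκ, coeff_reproKernel hw hks]
    ring
  have key := eq_C_mul_leadDual (g := X ^ n) hw hks hd (fun q hq => ?_) (by simp)
  · have hm : pairing w s (((X - C y) * κ - C (v.eval y) * u) * X ^ n) = - u.eval y := by
      -- `(X - y) X ^ n` has degree one too large for the reproducing property; subtracting `u`,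
      -- which is orthogonal to `κ`, repairs this.
      have hl : DegLT ((X - C y) * X ^ n - u) (n + 1) := by
        have : (X - C y) * X ^ n - u = -(u - X ^ (n + 1)) - C y * X ^ n := by ring
        rw [this]
        refine degree_sub_lt' (degLT_neg.2 (degree_orthoPoly_sub_lt w s (n + 1))) ?_
        exact (degree_C_mul_X_pow_le _ _).trans_lt (Nat.cast_lt.2 n.lt_succ_self)
      have h1 := pairing_reproKernel_mul hw hks y hl
      have h2 : pairing w s (u * X ^ n) = 0 :=
        pairing_orthoPoly_mul hw hks ((degree_X_pow_le _).trans_lt (Nat.cast_lt.2 n.lt_succ_self))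
      have h3 : pairing w s (u * κ) = 0 := pairing_orthoPoly_mul hw hks hκd
      rw [mul_comm] at h3
      have h4 : ((X - C y) * κ - C (v.eval y) * u) * X ^ n =
          κ * ((X - C y) * X ^ n - u) + κ * u - C (v.eval y) * (u * X ^ n) := by ring
      rw [h4, map_sub, map_add, pairing_C_mul, h2, h3, h1]
      simp
    rw [hm] at key
    rw [sub_eq_iff_eq_add.1 key, C_neg]
    ring
  -- Orthogonality to degree `< n`: the kernel evaluates `(X - y) q` at its zero `y`.
  · have h1 := pairing_reproKernel_mul hw hks y (degree_X_sub_C_mul_lt y hq)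
    have h2 : pairing w s (u * q) = 0 := pairing_orthoPoly_mul hw hks (degree_lt_succ hq)
    have h3 : ((X - C y) * κ - C (v.eval y) * u) * q = κ * ((X - C y) * q) -
        C (v.eval y) * (u * q) := by ring
    rw [h3, map_sub, pairing_C_mul, h2, h1]
    simp

lemma reproKernel_eval_mul (hw : ∀ x < s, 0 < w x) (hks : n + 1 ≤ s) (x y : ℝ) :
    (x - y) * (reproKernel w s (n + 1) y).eval x =
      (orthoPoly w s (n + 1)).eval x * (leadDual w s n).eval y -
        (leadDual w s n).eval x * (orthoPoly w s (n + 1)).eval y := by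
  have := congrArg (eval x) (christoffel_darboux hw hks y)
  simp only [eval_mul, eval_sub, eval_X, eval_C] at this
  rw [this]
  ring

lemma reproKernel_eval_self (hw : ∀ x < s, 0 < w x) (hks : n + 1 ≤ s) (y : ℝ) :
    (reproKernel w s (n + 1) y).eval y =
      (derivative (orthoPoly w s (n + 1))).eval y * (leadDual w s n).eval y -
        (derivative (leadDual w s n)).eval y * (orthoPoly w s (n + 1)).eval y := by
  have := congrArg (fun q => eval y (derivative q)) (christoffel_darboux hw hks y)
  simp only [derivative_mul, derivative_sub, derivative_X, derivative_C, eval_add, eval_mul,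
    eval_sub, eval_X, eval_C, sub_self, zero_mul, add_zero, zero_add, sub_zero,
    one_mul] at this
  rw [this]
  ring

/-! ### Adding one point to the support -/

/-- The ratio of the moment determinants of size `k` for the supports `{0, …, s}` and
`{0, …, s - 1}`. -/
noncomputable def growth (w : ℕ → ℝ) (s k : ℕ) : ℝ :=
  1 + w s * (reproKernel w s k s).eval (s : ℝ)

lemma growth_pos (hw : ∀ x < s + 1, 0 < w x) (hks : k ≤ s) : 0 < growth w s k := by
  have h1 := reproKernel_self_nonneg (fun x hx => hw x (by omega)) hks (s : ℝ)
  have h2 := hw s (by omega)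
  unfold growth
  positivity

/-- Sherman–Morrison: the new node adds `w(s) u(s) q(s)` to the pairing with `q`, and a multiple of
the kernel at `s` compensates. The kernel itself sees the new node, whence the division by `growth`.
-/
lemma orthoPoly_succ (hw : ∀ x < s + 1, 0 < w x) (hks : k ≤ s) :
    orthoPoly w (s + 1) k = orthoPoly w s k -
      C (w s / growth w s k * (orthoPoly w s k).eval (s : ℝ)) * reproKernel w s k s := by
  have hw' : ∀ x < s, 0 < w x := fun x hx => hw x (by omega)
  have hg := (growth_pos hw hks).ne'
  symm
  refine eq_orthoPoly hw (by omega) ?_ fun q hq => ?_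
  · rw [sub_right_comm]
    exact degree_sub_lt' (degree_orthoPoly_sub_lt w s k)
      (degree_C_mul_lt _ (degree_reproKernel_lt w s k s))
  · rw [sub_mul, map_sub, mul_assoc, pairing_C_mul, pairing_succ, pairing_succ,
      pairing_orthoPoly_mul hw' hks hq, pairing_reproKernel_mul hw' hks _ hq, eval_mul, eval_mul]
    have : growth w s k = 1 + w s * (reproKernel w s k s).eval (s : ℝ) := rfl
    field_simp
    rw [this]
    ring

lemma leadDual_succ (hw : ∀ x < s + 1, 0 < w x) (hks : n + 1 ≤ s) :
    leadDual w (s + 1) n = leadDual w s n -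
      C (w s / growth w s (n + 1) * (leadDual w s n).eval (s : ℝ)) *
        reproKernel w s (n + 1) s := by
  have hw' : ∀ x < s, 0 < w x := fun x hx => hw x (by omega)
  have hg := (growth_pos hw hks).ne'
  symm
  refine eq_dualPoly hw (by omega) _ ?_ fun q hq => ?_
  · exact degree_sub_lt' (degree_leadDual_lt w s n)
      (degree_C_mul_lt _ (degree_reproKernel_lt w s (n + 1) s))
  · rw [sub_mul, map_sub, mul_assoc, pairing_C_mul, pairing_succ, pairing_succ,
      pairing_leadDual_mul hw' hks hq, pairing_reproKernel_mul hw' hks _ hq, eval_mul, eval_mul,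
      lcoeff_apply]
    have : growth w s (n + 1) = 1 + w s * (reproKernel w s (n + 1) s).eval (s : ℝ) := rfl
    field_simp
    rw [this]
    ring

/-- Matrix determinant lemma: the new node adds a rank-one matrix built from the powers of `s`. -/
lemma det_momentMatrix_succ (hw : ∀ x < s + 1, 0 < w x) (hks : k ≤ s) :
    (momentMatrix w (s + 1) k).det = (momentMatrix w s k).det * growth w s k := by
  have hw' : ∀ x < s, 0 < w x := fun x hx => hw x (by omega)
  have hdet : IsUnit (momentMatrix w s k).det := (det_momentMatrix_ne_zero hw' hks).isUnit
  have h1 : momentMatrix w (s + 1) k = momentMatrix w s k +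
      Matrix.replicateCol Unit (fun i : Fin k => w s * (s : ℝ) ^ (i : ℕ)) *
        Matrix.replicateRow Unit (fun i : Fin k => (s : ℝ) ^ (i : ℕ)) := by
    ext i j
    simp [momentMatrix, pairing_succ, Matrix.mul_apply, mul_assoc]
  rw [h1, Matrix.det_add_replicateCol_mul_replicateRow hdet]
  congr 1
  rw [growth, reproKernel, dualPoly, ← leval_apply, linearMap_ext_ofCoeffs]
  simp [Matrix.mul_apply, Matrix.mulVec, dotProduct, sum_mul, mul_sum]
  rw [sum_comm]
  refine sum_congr rfl fun i _ => sum_congr rfl fun j _ => ?_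
  ring

end TruncatedWeight

end

/-! ### Scalar form of the rank-one update, zeros, and ladder relations. -/

section

open Polynomial Finset

namespace TruncatedWeight

variable {w : ℕ → ℝ} {s k n : ℕ}

lemma degLT_of_sub_X_pow {f : ℝ[X]} (hf : DegLT (f - X ^ k) k) : DegLT f (k + 1) := by
  rw [← sub_add_cancel f (X ^ k)]
  exact degree_add_lt' (degree_lt_succ hf)
    ((degree_X_pow_le _).trans_lt (Nat.cast_lt.2 k.lt_succ_self))

lemma coeff_of_sub_X_pow {f : ℝ[X]} (hf : DegLT (f - X ^ k) k) : f.coeff k = 1 := by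
  have := degLT_iff.1 hf k le_rfl
  rw [coeff_sub, coeff_X_pow_self] at this
  linarith

lemma degLT_sub_of_sub_X_pow {f g : ℝ[X]} (hf : DegLT (f - X ^ k) k) (hg : DegLT (g - X ^ k) k) :
    DegLT (f - g) k := by
  rw [← sub_sub_sub_cancel_right f g (X ^ k)]
  exact degree_sub_lt' hf hg

lemma degLT_X_pow (n : ℕ) : DegLT (X ^ n) (n + 1) :=
  (degree_X_pow_le _).trans_lt (Nat.cast_lt.2 n.lt_succ_self)

lemma degLT_taylor {f : ℝ[X]} (r : ℝ) : DegLT (taylor r f) n ↔ DegLT f n := by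
  unfold DegLT
  rw [degree_taylor]

lemma coeff_taylor_of_sub_X_pow {f : ℝ[X]} (hf : DegLT (f - X ^ (n + 1)) (n + 1)) (r : ℝ) :
    (taylor r f).coeff n = f.coeff n + (n + 1) * r := by
  have h0 : DegLT (f - X ^ (n + 1) - C ((f - X ^ (n + 1)).coeff n) * X ^ n) n :=
    degree_sub_leading_lt hf
  have h1 := degLT_iff.1 ((degLT_taylor r).2 h0) n le_rfl
  have hc : ((X + C r) ^ n).coeff n = 1 := by
    rw [coeff_X_add_C_pow]
    simp
  simp only [map_sub, taylor_mul, taylor_C, taylor_X_pow, coeff_sub, coeff_X_pow,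
    coeff_X_add_C_pow, Nat.choose_succ_self_right] at h1
  simp only [Nat.left_eq_add, one_ne_zero, ↓reduceIte, map_zero, sub_zero,
    add_tsub_cancel_left, pow_one, coeff_C_mul, hc] at h1
  push_cast at h1
  linarith

lemma pairing_orthoPoly_mul_monic (hw : ∀ x < s, 0 < w x) (hks : k ≤ s) {f : ℝ[X]}
    (hf : DegLT (f - X ^ k) k) :
    pairing w s (orthoPoly w s k * f) = pairing w s (orthoPoly w s k * orthoPoly w s k) := by
  have := pairing_orthoPoly_mul hw hks
    (degLT_sub_of_sub_X_pow hf (degree_orthoPoly_sub_lt w s k))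
  rw [mul_sub, map_sub] at this
  linarith

/-- Subtracting the orthogonal polynomial, which is orthogonal to `leadDual`, lowers the degree into
the range of the coefficient functional. -/
lemma pairing_leadDual_mul_monic (hw : ∀ x < s, 0 < w x) (hks : n + 1 ≤ s) {f : ℝ[X]}
    (hf : DegLT (f - X ^ (n + 1)) (n + 1)) :
    pairing w s (leadDual w s n * f) = f.coeff n - (orthoPoly w s (n + 1)).coeff n := by
  have h1 := pairing_leadDual_mul hw hks
    (degLT_sub_of_sub_X_pow hf (degree_orthoPoly_sub_lt w s (n + 1)))
  have h2 := pairing_orthoPoly_mul hw hks (degree_leadDual_lt w s n)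
  rw [mul_comm] at h2
  rw [mul_sub, map_sub, h2, coeff_sub] at h1
  linarith

/-- The constant `w(s) / growth` by which the rank-one update of the orthogonal polynomials is
scaled. -/
noncomputable def rate (w : ℕ → ℝ) (s k : ℕ) : ℝ := w s / growth w s k

lemma rate_pos (hw : ∀ x < s + 1, 0 < w x) (hks : k ≤ s) : 0 < rate w s k :=
  div_pos (hw s (by omega)) (growth_pos hw hks)

lemma rate_mul_kernel (hw : ∀ x < s + 1, 0 < w x) (hks : k ≤ s) :
    rate w s k * (reproKernel w s k s).eval (s : ℝ) = 1 - 1 / growth w s k := by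
  have := (growth_pos hw hks).ne'
  have h : growth w s k = 1 + w s * (reproKernel w s k s).eval (s : ℝ) := rfl
  rw [rate]
  field_simp
  linarith

lemma coeff_orthoPoly_succ (hw : ∀ x < s + 1, 0 < w x) (hks : n + 1 ≤ s) :
    (orthoPoly w (s + 1) (n + 1)).coeff n = (orthoPoly w s (n + 1)).coeff n -
      rate w s (n + 1) * (orthoPoly w s (n + 1)).eval (s : ℝ) * (leadDual w s n).eval (s : ℝ) := by
  rw [orthoPoly_succ hw hks, coeff_sub, coeff_C_mul,
    coeff_reproKernel (fun x hx => hw x (by omega)) hks, rate]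

lemma eval_orthoPoly_succ_self (hw : ∀ x < s + 1, 0 < w x) (hks : k ≤ s) :
    (orthoPoly w (s + 1) k).eval (s : ℝ) = (orthoPoly w s k).eval (s : ℝ) / growth w s k := by
  have h := rate_mul_kernel hw hks
  rw [orthoPoly_succ hw hks, eval_sub, eval_mul, eval_C, ← rate, mul_right_comm, h]
  ring

lemma eval_leadDual_succ_self (hw : ∀ x < s + 1, 0 < w x) (hks : n + 1 ≤ s) :
    (leadDual w (s + 1) n).eval (s : ℝ) =
      (leadDual w s n).eval (s : ℝ) / growth w s (n + 1) := by
  have h := rate_mul_kernel hw hks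
  rw [leadDual_succ hw hks, eval_sub, eval_mul, eval_C, ← rate, mul_right_comm, h]
  ring

lemma pairing_orthoPoly_succ_self (hw : ∀ x < s + 1, 0 < w x) (hks : k ≤ s) :
    pairing w (s + 1) (orthoPoly w (s + 1) k * orthoPoly w (s + 1) k) =
      pairing w s (orthoPoly w s k * orthoPoly w s k) +
        rate w s k * (orthoPoly w s k).eval (s : ℝ) ^ 2 := by
  have hw' : ∀ x < s, 0 < w x := fun x hx => hw x (by omega)
  -- One factor is replaced by the old monic polynomial, so that the kernel term pairs to zero on
  -- the old nodes.
  rw [← pairing_orthoPoly_mul_monic hw (by omega) (degree_orthoPoly_sub_lt w s k), pairing_succ,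
    eval_mul, eval_orthoPoly_succ_self hw hks]
  nth_rewrite 1 [orthoPoly_succ hw hks]
  rw [sub_mul, map_sub, mul_assoc, pairing_C_mul, mul_comm (reproKernel w s k s),
    pairing_orthoPoly_mul hw' hks (degree_reproKernel_lt w s k s), rate]
  ring

/-- The factor `x - s` allows Christoffel–Darboux to eliminate the kernel, so the update closes on
the pair (`orthoPoly`, `leadDual`). -/
lemma eval_orthoPoly_succ_mul (hw : ∀ x < s + 1, 0 < w x) (hks : n + 1 ≤ s) (x : ℝ) :
    (x - s) * (orthoPoly w (s + 1) (n + 1)).eval x = (x - s) * (orthoPoly w s (n + 1)).eval x -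
      rate w s (n + 1) * (orthoPoly w s (n + 1)).eval (s : ℝ) *
        ((orthoPoly w s (n + 1)).eval x * (leadDual w s n).eval (s : ℝ) -
          (leadDual w s n).eval x * (orthoPoly w s (n + 1)).eval (s : ℝ)) := by
  have h := reproKernel_eval_mul (n := n) (fun x hx => hw x (by omega)) hks x s
  rw [← h, orthoPoly_succ hw hks, eval_sub, eval_mul, eval_C, ← rate]
  ring

lemma eval_leadDual_succ_mul (hw : ∀ x < s + 1, 0 < w x) (hks : n + 1 ≤ s) (x : ℝ) :
    (x - s) * (leadDual w (s + 1) n).eval x = (x - s) * (leadDual w s n).eval x -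
      rate w s (n + 1) * (leadDual w s n).eval (s : ℝ) *
        ((orthoPoly w s (n + 1)).eval x * (leadDual w s n).eval (s : ℝ) -
          (leadDual w s n).eval x * (orthoPoly w s (n + 1)).eval (s : ℝ)) := by
  have h := reproKernel_eval_mul (n := n) (fun x hx => hw x (by omega)) hks x s
  rw [← h, leadDual_succ hw hks, eval_sub, eval_mul, eval_C, ← rate]
  ring

/-! ### Location of the zeros -/

/-- `f q = (x - ξ) q²` has constant sign on the nodes when `ξ` lies outside their interior, so a
vanishing weighted sum vanishes termwise. -/
lemma eval_eq_zero_of_root (hw : ∀ x < s, 0 < w x) {ξ : ℝ} (hξ : ξ ≤ 0 ∨ (s : ℝ) ≤ ξ) {f q : ℝ[X]}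
    (hf : f = (X - C ξ) * q) (h : pairing w s (f * q) = 0) : ∀ x < s, f.eval (x : ℝ) = 0 := by
  rw [pairing_apply] at h
  have he : ∀ x : ℕ, (f * q).eval (x : ℝ) = (x - ξ) * q.eval (x : ℝ) ^ 2 := fun x => by
    rw [hf]
    simp
    ring
  have hz : ∀ x ∈ range s, w x * (f * q).eval (x : ℝ) = 0 := by
    rcases hξ with hξ | hξ
    · refine (sum_eq_zero_iff_of_nonneg fun x hx => ?_).1 h
      rw [he]
      have := hw x (mem_range.1 hx)
      have : 0 ≤ (x : ℝ) - ξ := by linarith [(Nat.cast_nonneg x : (0 : ℝ) ≤ x)]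
      positivity
    · refine (sum_eq_zero_iff_of_nonpos fun x hx => ?_).1 h
      rw [he]
      have h1 := hw x (mem_range.1 hx)
      have : (x : ℝ) ≤ s := by exact_mod_cast (mem_range.1 hx).le
      exact mul_nonpos_of_nonneg_of_nonpos h1.le
        (mul_nonpos_of_nonpos_of_nonneg (by linarith) (sq_nonneg _))
  intro x hx
  have := hz x (mem_range.2 hx)
  rw [he, mul_eq_zero, mul_eq_zero, pow_eq_zero_iff two_ne_zero] at this
  rw [hf]
  simp only [eval_mul, eval_sub, eval_X, eval_C, mul_eq_zero]
  exact this.resolve_left (hw x hx).ne'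

lemma degLT_of_X_sub_C_mul {ξ : ℝ} {q : ℝ[X]} (h : DegLT ((X - C ξ) * q) (n + 1)) :
    DegLT q n := by
  rcases eq_or_ne q 0 with rfl | hq
  · simp [DegLT]
  · have h0 : (X - C ξ) * q ≠ 0 := mul_ne_zero (X_sub_C_ne_zero ξ) hq
    unfold DegLT at h ⊢
    rw [← natDegree_lt_iff_degree_lt h0, natDegree_mul (X_sub_C_ne_zero ξ) hq,
      natDegree_X_sub_C] at h
    rw [← natDegree_lt_iff_degree_lt hq]
    omega

lemma orthoPoly_ne_zero (w : ℕ → ℝ) (s k : ℕ) : orthoPoly w s k ≠ 0 := fun h => by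
  have := coeff_orthoPoly_self w s k
  simp [h] at this

lemma leadDual_ne_zero (hw : ∀ x < s, 0 < w x) (hks : n + 1 ≤ s) : leadDual w s n ≠ 0 := fun h => by
  have := pairing_leadDual_mul hw hks (degLT_X_pow n)
  simp [h] at this

lemma leadDual_eval_ne_zero (hw : ∀ x < s, 0 < w x) (hks : n + 1 ≤ s) {ξ : ℝ}
    (hξ : ξ ≤ 0 ∨ (s : ℝ) ≤ ξ) : (leadDual w s n).eval ξ ≠ 0 := fun h => by
  obtain ⟨q, hq⟩ := dvd_iff_isRoot.2 h
  have hqd : DegLT q n := degLT_of_X_sub_C_mul (hq ▸ degree_leadDual_lt w s n)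
  refine leadDual_ne_zero hw hks (eq_zero_of_eval_eq_zero hks (degree_leadDual_lt w s n)
    (eval_eq_zero_of_root hw hξ hq ?_))
  rw [pairing_leadDual_mul hw hks (degree_lt_succ hqd), degLT_iff.1 hqd n le_rfl]

/-- Only `ξ ≥ s` is allowed: for `k = s` the polynomial is the falling factorial, which vanishes at
`0`. Beyond the nodes `x - ξ ≠ 0`, so the cofactor `q`, of degree `< k`, vanishes on all of them. -/
lemma orthoPoly_eval_ne_zero (hw : ∀ x < s, 0 < w x) (hks : k ≤ s) {ξ : ℝ}
    (hξ : (s : ℝ) ≤ ξ) : (orthoPoly w s k).eval ξ ≠ 0 := fun h => by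
  obtain ⟨q, hq⟩ := dvd_iff_isRoot.2 h
  have hqd : DegLT q k := degLT_of_X_sub_C_mul (hq ▸ degree_orthoPoly_lt w s k)
  have hz := eval_eq_zero_of_root hw (Or.inr hξ) hq (pairing_orthoPoly_mul hw hks hqd)
  have hq0 : q = 0 := by
    refine eq_zero_of_eval_eq_zero hks hqd fun x hx => ?_
    have := hz x hx
    rw [hq, eval_mul, mul_eq_zero] at this
    refine this.resolve_left ?_
    have : (x : ℝ) < s := by exact_mod_cast hx
    simp only [eval_sub, eval_X, eval_C]
    linarith
  exact orthoPoly_ne_zero w s k (by rw [hq, hq0, mul_zero])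

lemma eval_pos_of_no_root {f : ℝ[X]} (hf : 0 < f.leadingCoeff) {y : ℝ}
    (h : ∀ ξ, y ≤ ξ → f.eval ξ ≠ 0) : 0 < f.eval y := by
  by_contra! hy
  obtain ⟨z, hyz, hz⟩ : ∃ z, y ≤ z ∧ 0 ≤ f.eval z := by
    rcases lt_or_ge 0 f.degree with hd | hd
    · have := (f.tendsto_atTop_of_leadingCoeff_nonneg hd hf.le)
      obtain ⟨z, hz⟩ := ((this.eventually_ge_atTop 0).and
        (Filter.eventually_ge_atTop y)).exists
      exact ⟨z, hz.2, hz.1⟩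
    · refine ⟨y, le_rfl, ?_⟩
      rw [eq_C_of_degree_le_zero hd] at hf ⊢
      rw [leadingCoeff_C] at hf
      rw [eval_C]
      exact hf.le
  obtain ⟨ξ, hξ, h0⟩ := intermediate_value_Icc hyz f.continuousOn ⟨hy, hz⟩
  exact h ξ hξ.1 h0

lemma coeff_leadDual_pos (hw : ∀ x < s, 0 < w x) (hks : n + 1 ≤ s) :
    0 < (leadDual w s n).coeff n := by
  rw [← pairing_leadDual_mul hw hks (degree_leadDual_lt w s n)]
  refine lt_of_le_of_ne (pairing_self_nonneg hw _) fun h => ?_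
  exact leadDual_ne_zero hw hks
    (eq_zero_of_pairing_self hw hks (degree_leadDual_lt w s n) h.symm)

lemma leadDual_eval_pos (hw : ∀ x < s, 0 < w x) (hks : n + 1 ≤ s) :
    0 < (leadDual w s n).eval (s : ℝ) := by
  refine eval_pos_of_no_root ?_ fun ξ hξ => leadDual_eval_ne_zero hw hks (Or.inr hξ)
  have h := coeff_leadDual_pos hw hks
  have hd : (leadDual w s n).natDegree = n := by
    refine le_antisymm ?_ (le_natDegree_of_ne_zero h.ne')
    have := (natDegree_lt_iff_degree_lt (leadDual_ne_zero hw hks)).2 (degree_leadDual_lt w s n)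
    omega
  rwa [leadingCoeff, hd]

lemma orthoPoly_eval_pos (hw : ∀ x < s, 0 < w x) (hks : k ≤ s) :
    0 < (orthoPoly w s k).eval (s : ℝ) := by
  refine eval_pos_of_no_root ?_ fun ξ hξ => orthoPoly_eval_ne_zero hw hks hξ
  have h := coeff_orthoPoly_self w s k
  have hd : (orthoPoly w s k).natDegree = k := by
    refine le_antisymm ?_ (le_natDegree_of_ne_zero (by rw [h]; exact one_ne_zero))
    have := (natDegree_lt_iff_degree_lt (orthoPoly_ne_zero w s k)).2 (degree_orthoPoly_lt w s k)
    omega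
  rw [leadingCoeff, hd, h]
  exact one_pos

/-! ### Ladder relations for a weight satisfying a Pearson equation -/

lemma X_mul_taylor (f : ℝ[X]) : X * taylor (-1) f = taylor (-1) ((X + 1) * f) := by
  rw [taylor_mul, map_add, taylor_X, taylor_one]
  simp

/-- Summation by shift: the factor `X` kills the node `0`, and the Pearson equation transports the
weight from `x + 1` to `x`. This is how level `s + 1` becomes level `s`. -/
lemma pairing_shift {c M : ℝ} (hP : ∀ x : ℕ, w (x + 1) * ((x : ℝ) + 1) = c * (w x * (M - x)))
    (s : ℕ) (f g : ℝ[X]) :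
    pairing w (s + 1) (X * taylor (-1) f * g) = c * pairing w s ((C M - X) * f * taylor 1 g) := by
  rw [pairing_apply, pairing_apply, sum_range_succ', mul_sum]
  simp only [eval_mul, eval_X, taylor_eval, eval_sub, eval_C, Nat.cast_zero, zero_mul, mul_zero,
    add_zero, Nat.cast_add, Nat.cast_one, add_neg_cancel_right]
  refine sum_congr rfl fun x _ => ?_
  linear_combination (eval (x : ℝ) f * eval ((x : ℝ) + 1) g) * hP x

lemma degLT_C_sub_X_mul {q : ℝ[X]} (M : ℝ) (hq : DegLT q n) : DegLT ((C M - X) * q) (n + 1) := by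
  rw [← neg_sub, neg_mul, degLT_neg]
  exact degree_X_sub_C_mul_lt M hq

lemma taylor_sub_X_pow (r : ℝ) (k : ℕ) : DegLT (taylor r (X ^ k) - X ^ k) k := by
  refine degree_lt_of_succ (degree_sub_lt' ((degLT_taylor r).2 (degLT_X_pow k)) (degLT_X_pow k)) ?_
  rw [taylor_X_pow, coeff_sub, coeff_X_add_C_pow]
  simp

lemma X_mul_sub_X_pow {f : ℝ[X]} (hf : DegLT (f - X ^ n) n) :
    DegLT (X * f - X ^ (n + 1)) (n + 1) := by
  rw [pow_succ', ← mul_sub]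
  exact degree_X_mul_lt hf

lemma coeff_X_mul_taylor_X_pow (n : ℕ) : (X * taylor (-1) (X ^ n : ℝ[X])).coeff n = -(n : ℝ) := by
  rw [X_mul_taylor, coeff_taylor_of_sub_X_pow]
  · rw [add_mul, one_mul, ← pow_succ']
    simp [coeff_X_pow]
  · rw [add_mul, one_mul, ← pow_succ', add_sub_cancel_left]
    exact degLT_X_pow n

/-- By `pairing_shift` the left side is orthogonal to degree `< n` at level `s + 1`. Subtracting `(X
+ a) u'`, with `a` matching the two top coefficients, leaves degree at most `n`, hence a multiple of
`leadDual`. -/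
lemma orthoPoly_ladder {c M : ℝ}
    (hP : ∀ x : ℕ, w (x + 1) * ((x : ℝ) + 1) = c * (w x * (M - x)))
    (hw : ∀ x < s + 1, 0 < w x) (hks : n + 1 ≤ s) :
    X * taylor (-1) (orthoPoly w s (n + 1)) =
      (X + C ((orthoPoly w s (n + 1)).coeff n - (n + 1) - (orthoPoly w (s + 1) (n + 1)).coeff n)) *
          orthoPoly w (s + 1) (n + 1) -
        C (c * pairing w s (orthoPoly w s (n + 1) * orthoPoly w s (n + 1)) +
          pairing w (s + 1) (orthoPoly w (s + 1) (n + 1) * orthoPoly w (s + 1) (n + 1))) *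
          leadDual w (s + 1) n := by
  have hw' : ∀ x < s, 0 < w x := fun x hx => hw x (by omega)
  set u := orthoPoly w s (n + 1)
  set u' := orthoPoly w (s + 1) (n + 1)
  have hud : DegLT (u - X ^ (n + 1)) (n + 1) := degree_orthoPoly_sub_lt w s (n + 1)
  set a := u.coeff n - (n + 1) - u'.coeff n
  have h1 : (taylor (-1) u).coeff n = u.coeff n - (n + 1) := by
    rw [coeff_taylor_of_sub_X_pow hud]
    ring
  have h2 : (taylor (-1) u).coeff (n + 1) = 1 := by
    have hT := degree_add_lt' ((degLT_taylor (-1)).2 hud) (taylor_sub_X_pow (-1) (n + 1))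
    rw [map_sub, sub_add_sub_cancel] at hT
    exact coeff_of_sub_X_pow hT
  have h3 : DegLT (taylor (-1) u) (n + 2) := (degLT_taylor _).2 (degree_orthoPoly_lt w s (n + 1))
  have hd : DegLT (X * taylor (-1) u - (X + C a) * u') (n + 1) := by
    have e : (X + C a) * u' = (X - C (-a)) * u' := by simp
    refine degree_lt_of_succ (degree_lt_of_succ (degree_sub_lt' (degree_X_mul_lt h3) ?_) ?_) ?_
    · rw [e]
      exact degree_X_sub_C_mul_lt _ (degree_orthoPoly_lt w (s + 1) (n + 1))
    · rw [coeff_sub, coeff_X_mul, h2, add_mul, coeff_add, coeff_X_mul, coeff_C_mul,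
        coeff_orthoPoly_self, degLT_iff.1 (degree_orthoPoly_lt w (s + 1) (n + 1)) _ le_rfl]
      ring
    · rw [coeff_sub, coeff_X_mul, h1, add_mul, coeff_add, coeff_X_mul, coeff_C_mul,
        coeff_orthoPoly_self]
      ring
  -- The test polynomial is the shifted power, so that `pairing_shift` turns it back into `X ^ n` at
  -- level `s`.
  have key := eq_C_mul_leadDual (g := taylor (-1) (X ^ n)) hw (by omega) hd (fun q hq => ?_)
    (taylor_sub_X_pow _ _)
  · rw [eq_add_of_sub_eq key]
    have : pairing w (s + 1) ((X * taylor (-1) u - (X + C a) * u') * taylor (-1) (X ^ n)) =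
        -(c * pairing w s (u * u) + pairing w (s + 1) (u' * u')) := by
      have e1 : pairing w s ((C M - X) * u * X ^ n) = - pairing w s (u * u) := by
        have e : (C M - X) * u * X ^ n = C M * (u * X ^ n) - u * X ^ (n + 1) := by ring
        rw [e, map_sub, pairing_C_mul, pairing_orthoPoly_mul hw' hks (degLT_X_pow n),
          pairing_orthoPoly_mul_monic hw' hks (by simp)]
        ring
      have e2 : pairing w (s + 1) ((X + C a) * u' * taylor (-1) (X ^ n)) =
          pairing w (s + 1) (u' * u') := by
        have e : (X + C a) * u' * taylor (-1) (X ^ n) =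
          u' * (X * taylor (-1) (X ^ n)) + C a * (u' * taylor (-1) (X ^ n)) := by ring
        rw [e, map_add, pairing_C_mul, pairing_orthoPoly_mul hw (by omega)
          ((degLT_taylor _).2 (degLT_X_pow n)), pairing_orthoPoly_mul_monic hw (by omega)
            (X_mul_sub_X_pow (taylor_sub_X_pow _ _))]
        ring
      rw [sub_mul, map_sub, pairing_shift hP, taylor_taylor, e2]
      simp only [add_neg_cancel, taylor_zero, e1]
      ring
    rw [this, C_neg]
    ring
  · have hq' : DegLT (taylor 1 q) n := (degLT_taylor 1).2 hq
    have e1 := pairing_orthoPoly_mul hw' hks (degLT_C_sub_X_mul M hq')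
    have e2 : pairing w (s + 1) (u' * ((X - C (-a)) * q)) = 0 :=
      pairing_orthoPoly_mul hw (by omega) (degree_X_sub_C_mul_lt (-a) hq)
    have e3 : (X + C a) * u' * q = u' * ((X - C (-a)) * q) := by rw [C_neg]; ring
    rw [sub_mul, map_sub, pairing_shift hP, e3, e2,
      mul_comm (C M - X), mul_assoc, e1]
    simp

/-- Here the shifted polynomial is not itself orthogonal to degree `< n`: the factor `M - X`
produces a top coefficient, which the term `c X v'` cancels. The coefficient of `u'` removes the
remaining term of degree `n + 1`. -/
lemma leadDual_ladder {c M : ℝ}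
    (hP : ∀ x : ℕ, w (x + 1) * ((x : ℝ) + 1) = c * (w x * (M - x)))
    (hw : ∀ x < s + 1, 0 < w x) (hks : n + 1 ≤ s) :
    X * taylor (-1) (leadDual w s n) =
      C ((leadDual w s n).coeff n + c * (leadDual w (s + 1) n).coeff n) *
          orthoPoly w (s + 1) (n + 1) +
        (C (c * (M + (orthoPoly w s (n + 1)).coeff n - n -
          (orthoPoly w (s + 1) (n + 1)).coeff n)) - C c * X) * leadDual w (s + 1) n := by
  have hw' : ∀ x < s, 0 < w x := fun x hx => hw x (by omega)
  set u := orthoPoly w s (n + 1) with hu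
  set u' := orthoPoly w (s + 1) (n + 1) with hu'
  set v := leadDual w s n with hv
  set v' := leadDual w (s + 1) n with hv'
  set e := v.coeff n + c * v'.coeff n with he
  have h3 : DegLT (taylor (-1) v) (n + 1) := (degLT_taylor _).2 (degree_leadDual_lt w s n)
  have h1 : (taylor (-1) v).coeff n = v.coeff n := by
    have h := degLT_iff.1 ((degLT_taylor (-1)).2 (degree_sub_leading_lt (degree_leadDual_lt w s n)))
      n le_rfl
    have h' := degLT_iff.1 (taylor_sub_X_pow (-1) n) n le_rfl
    rw [map_sub, taylor_mul, taylor_C, coeff_sub, coeff_C_mul] at h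
    rw [coeff_sub, coeff_X_pow_self] at h'
    rw [eq_of_sub_eq_zero h'] at h
    linarith
  have hd : DegLT (X * taylor (-1) v - C e * u' + C c * (X * v')) (n + 1) := by
    refine degree_lt_of_succ (degree_add_lt' (degree_sub_lt' (degree_X_mul_lt h3)
      (degree_C_mul_lt _ (degree_orthoPoly_lt w (s + 1) (n + 1))))
      (degree_C_mul_lt _ (degree_X_mul_lt (degree_leadDual_lt w (s + 1) n)))) ?_
    rw [coeff_add, coeff_sub, coeff_X_mul, coeff_C_mul, coeff_C_mul, coeff_X_mul, h1, hu',
      coeff_orthoPoly_self, he]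
    ring
  have key := eq_C_mul_leadDual (g := taylor (-1) (X ^ n)) hw (by omega) hd (fun q hq => ?_)
    (taylor_sub_X_pow _ _)
  · have hsum : X * taylor (-1) v = (X * taylor (-1) v - C e * u' + C c * (X * v')) + C e * u' -
        C c * (X * v') := by ring
    rw [hsum, key]
    have : pairing w (s + 1) ((X * taylor (-1) v - C e * u' + C c * (X * v')) *
        taylor (-1) (X ^ n)) = c * (M + u.coeff n - n - u'.coeff n) := by
      have e1 : pairing w s ((C M - X) * v * X ^ n) = M + u.coeff n := by
        have e : (C M - X) * v * X ^ n = C M * (v * X ^ n) - v * X ^ (n + 1) := by ring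
        rw [e, map_sub, pairing_C_mul, pairing_leadDual_mul hw' hks (degLT_X_pow n),
          pairing_leadDual_mul_monic hw' hks (by simp)]
        simp [coeff_X_pow, hu]
      have e2 : pairing w (s + 1) (v' * (X * taylor (-1) (X ^ n))) = -n - u'.coeff n := by
        rw [pairing_leadDual_mul_monic hw (by omega)
            (X_mul_sub_X_pow (taylor_sub_X_pow _ _)), coeff_X_mul_taylor_X_pow]
      have e3 : pairing w (s + 1) (u' * taylor (-1) (X ^ n)) = 0 :=
        pairing_orthoPoly_mul hw (by omega) ((degLT_taylor _).2 (degLT_X_pow n))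
      have e4 : (X * taylor (-1) v - C e * u' + C c * (X * v')) * taylor (-1) (X ^ n) =
        X * taylor (-1) v * taylor (-1) (X ^ n) - C e * (u' * taylor (-1) (X ^ n)) +
          C c * (v' * (X * taylor (-1) (X ^ n))) := by ring
      rw [e4, map_add, map_sub, pairing_shift hP, taylor_taylor, pairing_C_mul, pairing_C_mul, e2,
        e3]
      simp only [add_neg_cancel, taylor_zero, e1]
      ring
    rw [this]
    ring
  · have hq' : DegLT (taylor 1 q) n := (degLT_taylor 1).2 hq
    have e1 := pairing_leadDual_mul hw' hks (degLT_C_sub_X_mul M hq')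
    have e2 := pairing_leadDual_mul hw (by omega) (degree_X_mul_lt hq)
    have e3 : pairing w (s + 1) (u' * q) = 0 :=
      pairing_orthoPoly_mul hw (by omega) (degree_lt_succ hq)
    have e4 : (X * taylor (-1) v - C e * u' + C c * (X * v')) * q =
        X * taylor (-1) v * q - C e * (u' * q) + C c * (v' * (X * q)) := by ring
    -- Translation preserves the top coefficient of `q`; for `n = 0` both sides are constant terms
    -- of multiples of `X`.
    have e5 : (X * taylor 1 q).coeff n = (X * q).coeff n := by
      rcases n with _ | n
      · simp
      · rw [coeff_X_mul, coeff_X_mul]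
        have h := degLT_iff.1 ((degLT_taylor 1).2 (degree_sub_leading_lt hq)) n le_rfl
        have h' := degLT_iff.1 (taylor_sub_X_pow 1 n) n le_rfl
        rw [map_sub, taylor_mul, taylor_C, coeff_sub, coeff_C_mul] at h
        rw [coeff_sub, coeff_X_pow_self] at h'
        rw [eq_of_sub_eq_zero h'] at h
        linarith
    rw [e4, map_add, map_sub, pairing_shift hP, pairing_C_mul, pairing_C_mul, e2, e3,
      mul_comm (C M - X), mul_assoc, e1, sub_mul, coeff_sub, coeff_C_mul, degLT_iff.1 hq' n le_rfl,
      e5]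
    ring

end TruncatedWeight

end

/-- The relations between two consecutive steps of the Krawtchouk ladder, in scalar form.
Here `w = α' / (β' e)`, `r = β / β'`, and primes denote the next step. -/
structure LadderStep (s N k t a e g w r T' e' g' : ℝ) : Prop where
  hs : 0 < s
  hsN : s < N
  hkN : k ≤ N
  ht : t < 0
  he : 0 < e
  hg : 0 < g
  hw : 0 < w
  hr : 0 < r
  he' : 0 < e'
  hT' : 0 < T'
  hg' : g' * e' = w * e
  hα : (s + 1) * (g * r) = (s + 1 + a) * w + a
  hβ : (s + 1) * r = -t * ((N + 1 + a) * w + (N - s + a))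
  hb : (T' - k) * e' = (a + t * (a + k) * g - T' * w) * e
  hzero : e' * (w * (s + 1) - T' * (1 + w)) = e * w * (s + 1 + T' * (1 + w))

/-! ### Elimination: from the scalar ladder relations to the Painlevé recurrences. -/

namespace LadderStep

variable {s N k t a e g w r T' e' g' : ℝ} (h : LadderStep s N k t a e g w r T' e' g')
include h

/-- The sign is read off `hβ`, since `a` carries no sign of its own. -/
lemma q_pos : 0 < (N + 1 + a) * w + (N - s + a) := by
  have h1 : 0 < -t * ((N + 1 + a) * w + (N - s + a)) := by
    rw [← h.hβ]
    exact mul_pos (by linarith [h.hs]) h.hr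
  exact (pos_iff_pos_of_mul_pos h1).1 (by linarith [h.ht])

lemma neg_t_mul_q : -t * g * ((N + 1 + a) * w + (N - s + a)) = (s + 1 + a) * w + a := by
  linear_combination h.hα - g * h.hβ

lemma one_add_mul_q :
    (1 + t * g) * ((N + 1 + a) * w + (N - s + a)) = (N - s) * (1 + w) := by
  linear_combination -h.neg_t_mul_q

/-- Not automatic, since `t < 0 < g`: positivity comes from the product with the positive factor of
`q_pos`. -/
lemma one_add_pos : 0 < 1 + t * g := by
  have h1 : 0 < (1 + t * g) * ((N + 1 + a) * w + (N - s + a)) := by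
    rw [h.one_add_mul_q]
    exact mul_pos (by linarith [h.hsN]) (by linarith [h.hw])
  exact (pos_iff_pos_of_mul_pos h1).2 h.q_pos

lemma g'_pos : 0 < g' := by
  have h1 : 0 < g' * e' := by
    rw [h.hg']
    exact mul_pos h.hw h.he
  exact (pos_iff_pos_of_mul_pos h1).2 h.he'

lemma g'_mul : g' * (s + 1 + T' * (1 + w)) = w * (s + 1) - T' * (1 + w) := by
  have he' := h.he'.ne'
  apply mul_left_cancel₀ he'
  linear_combination (s + 1 + T' * (1 + w)) * h.hg' - h.hzero

lemma den_pos : 0 < s + 1 + T' * (1 + w) := by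
  have := h.hs
  have := h.hT'
  have := h.hw
  positivity

lemma num_pos : 0 < w * (s + 1) - T' * (1 + w) := by
  rw [← h.g'_mul]
  exact mul_pos h.g'_pos h.den_pos

/-- The next value of `f`. -/
lemma f_next : (s + 1) / (1 + g') - T' = (s + 1) / (1 + w) := by
  have h1 := h.g'_pos
  have h2 := h.hw
  have h3 := h.g'_mul
  rw [sub_eq_iff_eq_add, div_eq_iff (by positivity)]
  field_simp
  linear_combination -h3

lemma f_step : (s + 1) / (1 + w) = N + 1 + a + (s - N) / (1 + t * g) := by
  have h1 := h.one_add_pos.ne'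
  have h2 := h.hw
  have h3 := h.one_add_mul_q
  have h6 : (s - N) / (1 + t * g) = -((N + 1 + a) * w + (N - s + a)) / (1 + w) := by
    rw [div_eq_div_iff h1 (by positivity)]
    linear_combination h3
  rw [h6]
  field_simp
  ring

/-- Eliminates `g'`: `hb` is first freed of `e` and `e'` by means of `g' e' = w e`, then combined
with `g'_mul`. -/
lemma t'_equation :
    T' * (1 + w) * (w * (s + 1 - k) + a + t * (a + k) * g) =
      w * (s + 1) * ((a + k) * (1 + t * g)) := by
  have h1 : (T' - k) * w = (a + t * (a + k) * g - T' * w) * g' := by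
    apply mul_right_cancel₀ (mul_ne_zero h.he.ne' h.he'.ne')
    linear_combination w * e * h.hb - (a + t * (a + k) * g - T' * w) * e * h.hg'
  linear_combination (s + 1 + T' * (1 + w)) * h1 + (a + t * (a + k) * g - T' * w) * h.g'_mul

/-- The multiplicative d-P_V equation with denominators cleared, where the next `f` is `(s + 1) / (1
+ w)`. It is obtained by eliminating `T'` and then `a`. -/
lemma g_relation :
    g * g' * t * ((N + 1 - k) * (1 + w) - (s + 1)) = w * (k * (1 + w) - (s + 1) * w) := by
  have hs : s + 1 ≠ 0 := (add_pos h.hs one_pos).ne'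
  have h1 : g' * (w * (s + 1 - k) + a + t * (a + k) * g + w * ((a + k) * (1 + t * g))) =
      w * (w * (s + 1 - k) - k) := by
    apply mul_left_cancel₀ hs
    linear_combination (w * (s + 1 - k) + a + t * (a + k) * g) * h.g'_mul -
      (1 + g') * h.t'_equation
  linear_combination -h1 - g' * h.neg_t_mul_q

/-- If this vanished, `g_relation` would give `k (1 + w) = (s + 1) w`; adding the two equations
yields `N = s`. -/
lemma sub_f_ne_zero : (N + 1 - k) * (1 + w) - (s + 1) ≠ 0 := by
  intro h0
  have h1 := h.g_relation
  rw [h0, mul_zero] at h1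
  have h2 := (mul_eq_zero.1 h1.symm).resolve_left h.hw.ne'
  have := mul_pos (sub_pos.2 h.hsN) (by linarith [h.hw] : 0 < 1 + w)
  linarith

lemma g_step :
    g * g' = ((s + 1) / (1 + w) - 1 - s) * ((s + 1) / (1 + w) - 1 - s + k) /
      (t * ((s + 1) / (1 + w)) * ((s + 1) / (1 + w) - (N + 1 - k))) := by
  have hw := h.hw
  have hs := h.hs
  have ht := h.ht.ne
  have h0 := h.sub_f_ne_zero
  have h1 : (s + 1) / (1 + w) - (N + 1 - k) ≠ 0 := by
    intro h2
    apply h0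
    field_simp at h2
    linarith
  rw [eq_div_iff (by positivity)]
  field_simp
  linear_combination -(s + 1) * h.g_relation

lemma e_den :
    w * ((1 + t * g) * ((s + 1) / (1 + w)) + k - s - 1) =
      t * g * (w * ((s + 1) / (1 + w)) + g' * (N + 1 - k - (s + 1) / (1 + w))) := by
  have hw := h.hw
  field_simp
  linear_combination -h.g_relation

lemma e_den_ne_zero :
    (1 + t * g) * ((s + 1) / (1 + w)) + k - s - 1 ≠ 0 := by
  intro h0
  have h1 := h.e_den
  rw [h0, mul_zero] at h1
  have h2 := (mul_eq_zero.1 h1.symm).resolve_left (mul_ne_zero h.ht.ne h.hg.ne')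
  have hw := h.hw
  have hs := h.hs
  have hT' := h.hT'
  have h3 := h.num_pos
  have h4 := h.hkN
  -- This is what the vanishing factor becomes once `g'` is eliminated by `g'_mul`: a sum of two
  -- positive terms.
  have h5 : 0 < (1 + w) * T' * (s + 1) + (N + 1 - k) * (w * (s + 1) - T' * (1 + w)) := by
    have : 0 < N + 1 - k := by linarith
    positivity
  field_simp at h2
  have h6 : (1 + w) * ((1 + w) * T' * (s + 1) +
      (N + 1 - k) * (w * (s + 1) - T' * (1 + w))) = 0 := by
    linear_combination (s + 1 + T' * (1 + w)) * h2 -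
      ((N + 1 - k) * (1 + w) - (s + 1)) * h.g'_mul
  rcases mul_eq_zero.1 h6 with h7 | h7 <;> linarith

lemma e_step :
    e' = -t * e * g / g' *
      (((1 + g') * ((s + 1) / (1 + w)) + (k - N - 1) * g' - s - 1) /
        ((1 + t * g) * ((s + 1) / (1 + w)) + k - s - 1)) := by
  have h0 := h.e_den_ne_zero
  have h1 := h.e_den
  have hg' := h.g'_pos.ne'
  have hw := h.hw
  rw [div_mul_div_comm, eq_div_iff (mul_ne_zero hg' h0)]
  have h2 : w * ((s + 1) / (1 + w)) = s + 1 - (s + 1) / (1 + w) := by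
    field_simp
    ring
  linear_combination ((1 + t * g) * ((s + 1) / (1 + w)) + k - s - 1) * h.hg' + e * h1 +
    t * g * e * h2

lemma h_step : w = (1 + t * g) * ((s + 1) / (1 + w) - s - 1) / (t * (N - s)) * r := by
  have hw := h.hw
  have ht := h.ht.ne
  have h4 : N - s ≠ 0 := (sub_pos.2 h.hsN).ne'
  have h1 : (1 + t * g) * r * (s + 1) = -t * ((N - s) * (1 + w)) := by
    linear_combination (1 + t * g) * h.hβ - t * h.one_add_mul_q
  field_simp
  linear_combination w * h1

/-- Rewrites the bracket of the determinant recurrence through `t g - w`, the combination that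
appears in `growth_succ_sub`. -/
lemma det_factor :
    (1 + t * g) * ((1 + t * g) * ((s + 1) / (1 + w)) - s - 1) * r =
      -t * (N - s) * (t * g - w) := by
  have hw := h.hw
  have h1 : (1 + t * g) * r * (s + 1) = -t * ((N - s) * (1 + w)) := by
    linear_combination (1 + t * g) * h.hβ - t * h.one_add_mul_q
  have h2 : (1 + t * g) * ((s + 1) / (1 + w)) - s - 1 = (s + 1) * (t * g - w) / (1 + w) := by
    field_simp
    ring
  rw [h2]
  field_simp
  linear_combination (t * g - w) * h1

end LadderStep

/-! ### The Krawtchouk sequences and the relations they satisfy. -/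

section

open Polynomial Finset TruncatedWeight

namespace Krawtchouk

variable {N n s : ℕ} {p : ℝ}

lemma weight_pos (hp0 : 0 < p) (hp1 : p < 1) {x : ℕ} (hx : x ≤ N) : 0 < weight N p x := by
  have h1 : (0 : ℝ) < N.choose x := by exact_mod_cast Nat.choose_pos hx
  unfold weight
  positivity

lemma weight_pearson (hp1 : p < 1) (N x : ℕ) :
    weight N p (x + 1) * ((x : ℝ) + 1) = p / (1 - p) * (weight N p x * (N - x)) := by
  have h2 : 1 - p ≠ 0 := (sub_pos.2 hp1).ne'
  rcases lt_or_ge x N with hx | hx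
  · obtain ⟨m, rfl⟩ : ∃ m, N = x + 1 + m := ⟨N - (x + 1), by omega⟩
    have hc : ((x + 1 + m).choose (x + 1) : ℝ) * (x + 1) = (x + 1 + m).choose x * (m + 1) := by
      have := Nat.choose_succ_right_eq (x + 1 + m) x
      rw [show x + 1 + m - x = m + 1 by omega] at this
      exact_mod_cast this
    unfold weight
    rw [show x + 1 + m - (x + 1) = m by omega, show x + 1 + m - x = m + 1 by omega]
    push_cast
    field_simp
    linear_combination p ^ (x + 1) * (1 - p) ^ (m + 1) * hc
  · have h1 : weight N p (x + 1) = 0 := by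
      simp [weight, Nat.choose_eq_zero_of_lt (Nat.lt_succ_of_le hx)]
    have h3 : weight N p x * ((N : ℝ) - x) = 0 := by
      rcases hx.eq_or_lt with rfl | hx
      · simp
      · simp [weight, Nat.choose_eq_zero_of_lt hx]
    rw [h1, h3]
    simp

/-- The value at `s` of the monic orthogonal polynomial of degree `n + 1` on `{0, …, s - 1}`. -/
noncomputable def alphaSeq (N n : ℕ) (p : ℝ) (s : ℕ) : ℝ :=
  (orthoPoly (weight N p) s (n + 1)).eval (s : ℝ)

/-- The value at `s` of the orthogonal polynomial of degree `n` on `{0, …, s - 1}` divided by its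
squared norm. -/
noncomputable def betaSeq (N n : ℕ) (p : ℝ) (s : ℕ) : ℝ :=
  (leadDual (weight N p) s n).eval (s : ℝ)

/-- Minus the increment of the subleading coefficient of the orthogonal polynomial of degree
`n + 1`. -/
noncomputable def dropSeq (N n : ℕ) (p : ℝ) (s : ℕ) : ℝ :=
  rate (weight N p) s (n + 1) * alphaSeq N n p s * betaSeq N n p s

/-- The sequence `e` of the theorem. -/
noncomputable def eSeq (N n : ℕ) (p : ℝ) (s : ℕ) : ℝ :=
  -(orthoPoly (weight N p) (s + 1) (n + 1)).eval 0 / (leadDual (weight N p) (s + 1) n).eval 0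

/-- The sequence `g` of the theorem. -/
noncomputable def gSeq (N n : ℕ) (p : ℝ) (s : ℕ) : ℝ :=
  alphaSeq N n p s / (betaSeq N n p s * eSeq N n p s)

/-- The sequence `f` of the theorem. -/
noncomputable def fSeq (N n : ℕ) (p : ℝ) (s : ℕ) : ℝ :=
  s / (1 + gSeq N n p s) - dropSeq N n p s

/-- The off-diagonal coefficient of the ladder relation for the orthogonal polynomial of degree
`n + 1`. -/
noncomputable def bSeq (N n : ℕ) (p : ℝ) (s : ℕ) : ℝ :=
  -(p / (1 - p) * pairing (weight N p) s
      (orthoPoly (weight N p) s (n + 1) * orthoPoly (weight N p) s (n + 1)) +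
    pairing (weight N p) (s + 1)
      (orthoPoly (weight N p) (s + 1) (n + 1) * orthoPoly (weight N p) (s + 1) (n + 1)))

/-- The off-diagonal coefficient of the ladder relation for the orthogonal polynomial of degree
`n`. -/
noncomputable def cSeq (N n : ℕ) (p : ℝ) (s : ℕ) : ℝ :=
  (leadDual (weight N p) s n).coeff n + p / (1 - p) * (leadDual (weight N p) (s + 1) n).coeff n

section

variable (hp0 : 0 < p) (hp1 : p < 1)
include hp0 hp1

lemma weight_pos_of_lt (hs : s ≤ N) : ∀ x < s + 1, 0 < weight N p x :=
  fun _ hx => weight_pos hp0 hp1 (by omega)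

lemma alphaSeq_pos (hns : n + 1 ≤ s) (hs : s ≤ N) : 0 < alphaSeq N n p s :=
  orthoPoly_eval_pos (fun x hx => weight_pos_of_lt hp0 hp1 hs x (by omega)) hns

lemma betaSeq_pos (hns : n + 1 ≤ s) (hs : s ≤ N) : 0 < betaSeq N n p s :=
  leadDual_eval_pos (fun x hx => weight_pos_of_lt hp0 hp1 hs x (by omega)) hns

lemma dropSeq_pos (hns : n + 1 ≤ s) (hs : s ≤ N) : 0 < dropSeq N n p s :=
  mul_pos (mul_pos (rate_pos (weight_pos_of_lt hp0 hp1 hs) hns) (alphaSeq_pos hp0 hp1 hns hs))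
    (betaSeq_pos hp0 hp1 hns hs)

lemma cSeq_pos (hns : n + 1 ≤ s) (hs : s ≤ N) : 0 < cSeq N n p s := by
  have hw := weight_pos_of_lt hp0 hp1 hs
  have h1 := coeff_leadDual_pos (fun x hx => hw x (by omega)) hns
  have h2 := coeff_leadDual_pos (n := n) hw (by omega)
  unfold cSeq
  positivity

lemma eval_orthoPoly_ladder (hns : n + 1 ≤ s) (hs : s ≤ N) (x : ℝ) :
    x * (orthoPoly (weight N p) s (n + 1)).eval (x - 1) =
      (x + (dropSeq N n p s - (n + 1))) * (orthoPoly (weight N p) (s + 1) (n + 1)).eval x +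
        bSeq N n p s * (leadDual (weight N p) (s + 1) n).eval x := by
  have hw := weight_pos_of_lt hp0 hp1 hs
  have h := congrArg (eval x) (orthoPoly_ladder (weight_pearson hp1 N) hw hns)
  rw [coeff_orthoPoly_succ hw hns] at h
  simp only [eval_mul, eval_X, taylor_eval, eval_sub, eval_add, eval_C, ← sub_eq_add_neg] at h
  rw [h, bSeq, dropSeq, alphaSeq, betaSeq]
  ring

lemma eval_leadDual_ladder (hns : n + 1 ≤ s) (hs : s ≤ N) (x : ℝ) :
    x * (leadDual (weight N p) s n).eval (x - 1) =
      cSeq N n p s * (orthoPoly (weight N p) (s + 1) (n + 1)).eval x +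
        p / (1 - p) * (N + 1 + (dropSeq N n p s - (n + 1)) - x) *
          (leadDual (weight N p) (s + 1) n).eval x := by
  have hw := weight_pos_of_lt hp0 hp1 hs
  have h := congrArg (eval x) (leadDual_ladder (weight_pearson hp1 N) hw hns)
  rw [coeff_orthoPoly_succ hw hns] at h
  simp only [eval_mul, eval_X, taylor_eval, eval_sub, eval_add, eval_C, ← sub_eq_add_neg] at h
  rw [h, cSeq, dropSeq, alphaSeq, betaSeq]
  ring

lemma leadDual_eval_zero_ne (hns : n + 1 ≤ s) (hs : s ≤ N + 1) :
    (leadDual (weight N p) s n).eval 0 ≠ 0 :=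
  leadDual_eval_ne_zero (fun _ hx => weight_pos hp0 hp1 (by omega)) hns (Or.inl le_rfl)

lemma orthoPoly_eval_zero (hns : n + 1 ≤ s) (hs : s ≤ N) :
    (orthoPoly (weight N p) (s + 1) (n + 1)).eval 0 =
      -eSeq N n p s * (leadDual (weight N p) (s + 1) n).eval 0 := by
  have := leadDual_eval_zero_ne hp0 hp1 (show n + 1 ≤ s + 1 by omega) (Nat.succ_le_succ hs)
  rw [eSeq]
  field_simp

/-- The ladder relation at `x = 0`, where the left side vanishes; `cSeq_mul_eSeq` is its companion.
-/
lemma bSeq_eq (hns : n + 1 ≤ s) (hs : s ≤ N) :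
    bSeq N n p s = (dropSeq N n p s - (n + 1)) * eSeq N n p s := by
  have h0 := leadDual_eval_zero_ne hp0 hp1 (show n + 1 ≤ s + 1 by omega) (Nat.succ_le_succ hs)
  have h := eval_orthoPoly_ladder hp0 hp1 hns hs 0
  rw [orthoPoly_eval_zero hp0 hp1 hns hs] at h
  apply mul_right_cancel₀ h0
  linear_combination -h

lemma cSeq_mul_eSeq (hns : n + 1 ≤ s) (hs : s ≤ N) :
    cSeq N n p s * eSeq N n p s = p / (1 - p) * (N + 1 + (dropSeq N n p s - (n + 1))) := by
  have h0 := leadDual_eval_zero_ne hp0 hp1 (show n + 1 ≤ s + 1 by omega) (Nat.succ_le_succ hs)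
  have h := eval_leadDual_ladder hp0 hp1 hns hs 0
  rw [orthoPoly_eval_zero hp0 hp1 hns hs] at h
  apply mul_right_cancel₀ h0
  linear_combination h

/-- The sign comes from `c e`, which equals `p / (1 - p)` times `N - n + T > 0`, without inspecting
the two values at `0`. -/
lemma eSeq_pos (hns : n + 1 ≤ s) (hs : s ≤ N) : 0 < eSeq N n p s := by
  have hc := cSeq_pos hp0 hp1 hns hs
  have hT := dropSeq_pos hp0 hp1 hns hs
  have hN : (n : ℝ) + 1 ≤ N := by exact_mod_cast hns.trans hs
  have h : 0 < cSeq N n p s * eSeq N n p s := by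
    rw [cSeq_mul_eSeq hp0 hp1 hns hs]
    exact mul_pos (by positivity) (by linarith)
  exact (pos_iff_pos_of_mul_pos h).1 hc

lemma gSeq_pos (hns : n + 1 ≤ s) (hs : s ≤ N) : 0 < gSeq N n p s :=
  div_pos (alphaSeq_pos hp0 hp1 hns hs)
    (mul_pos (betaSeq_pos hp0 hp1 hns hs) (eSeq_pos hp0 hp1 hns hs))

lemma bSeq_succ (hns : n + 1 ≤ s) (hs : s < N) :
    bSeq N n p (s + 1) = bSeq N n p s -
      p / (1 - p) * (rate (weight N p) s (n + 1) * alphaSeq N n p s ^ 2) -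
        rate (weight N p) (s + 1) (n + 1) * alphaSeq N n p (s + 1) ^ 2 := by
  have hw := weight_pos_of_lt hp0 hp1 hs.le
  have hw' := weight_pos_of_lt hp0 hp1 (Nat.succ_le_of_lt hs)
  rw [bSeq, bSeq, pairing_orthoPoly_succ_self hw' (by omega), pairing_orthoPoly_succ_self hw hns,
    alphaSeq, alphaSeq]
  push_cast
  ring

/-- The rank-one update from level `s + 1` to `s + 2`, evaluated at `0` for both polynomials, with
the common value of `leadDual` cancelled. -/
lemma eSeq_relation (hns : n + 1 ≤ s) (hs : s < N) :
    eSeq N n p (s + 1) * (s + 1 - rate (weight N p) (s + 1) (n + 1) * betaSeq N n p (s + 1) *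
        (eSeq N n p s * betaSeq N n p (s + 1) + alphaSeq N n p (s + 1))) =
      (s + 1) * eSeq N n p s + rate (weight N p) (s + 1) (n + 1) * alphaSeq N n p (s + 1) *
        (eSeq N n p s * betaSeq N n p (s + 1) + alphaSeq N n p (s + 1)) := by
  have hw' := weight_pos_of_lt hp0 hp1 (Nat.succ_le_of_lt hs)
  have h0 := leadDual_eval_zero_ne hp0 hp1 (show n + 1 ≤ s + 1 by omega) (Nat.succ_le_succ hs.le)
  have h1 := eval_orthoPoly_succ_mul (n := n) hw' (by omega) 0
  have h2 := eval_leadDual_succ_mul (n := n) hw' (by omega) 0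
  rw [orthoPoly_eval_zero hp0 hp1 hns hs.le] at h1 h2
  rw [orthoPoly_eval_zero hp0 hp1 (by omega) (Nat.succ_le_of_lt hs), ← alphaSeq, ← betaSeq] at h1
  rw [← alphaSeq, ← betaSeq] at h2
  push_cast at h1 h2
  apply mul_right_cancel₀ h0
  linear_combination h1 + eSeq N n p (s + 1) * h2

lemma ladderStep (hns : n + 1 ≤ s) (hs : s < N) :
    LadderStep s N (n + 1) (p / (p - 1)) (dropSeq N n p s - (n + 1)) (eSeq N n p s) (gSeq N n p s)
      (alphaSeq N n p (s + 1) / (betaSeq N n p (s + 1) * eSeq N n p s))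
      (betaSeq N n p s / betaSeq N n p (s + 1)) (dropSeq N n p (s + 1)) (eSeq N n p (s + 1))
      (gSeq N n p (s + 1)) := by
  have hns' : n + 1 ≤ s + 1 := by omega
  have hs' : s + 1 ≤ N := hs
  have ht : p / (1 - p) = -(p / (p - 1)) := by
    rw [← neg_sub, div_neg]
  have he := eSeq_pos hp0 hp1 hns hs.le
  have he' := eSeq_pos hp0 hp1 hns' hs'
  have hα' := alphaSeq_pos hp0 hp1 hns' hs'
  have hβ := betaSeq_pos hp0 hp1 hns hs.le
  have hβ' := betaSeq_pos hp0 hp1 hns' hs'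
  -- At `x = s + 1` the shifted side is evaluated at `s`, so only the `α` and `β` of levels `s` and
  -- `s + 1` occur.
  have l1 := eval_orthoPoly_ladder hp0 hp1 hns hs.le (s + 1)
  have l2 := eval_leadDual_ladder hp0 hp1 hns hs.le (s + 1)
  rw [add_sub_cancel_right] at l1 l2
  have l1' : ((s : ℝ) + 1) * alphaSeq N n p s = (s + 1 + (dropSeq N n p s - (n + 1))) *
      alphaSeq N n p (s + 1) + bSeq N n p s * betaSeq N n p (s + 1) := by
    simpa [alphaSeq, betaSeq] using l1
  have l2' : ((s : ℝ) + 1) * betaSeq N n p s = cSeq N n p s * alphaSeq N n p (s + 1) +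
      p / (1 - p) * (N + 1 + (dropSeq N n p s - (n + 1)) - (s + 1)) * betaSeq N n p (s + 1) := by
    simpa [alphaSeq, betaSeq] using l2
  have hb := bSeq_eq hp0 hp1 hns hs.le
  have hb' := bSeq_eq hp0 hp1 hns' hs'
  have hc := cSeq_mul_eSeq hp0 hp1 hns hs.le
  have hbs := bSeq_succ hp0 hp1 hns hs
  have her := eSeq_relation hp0 hp1 hns hs
  have hT : dropSeq N n p s =
    rate (weight N p) s (n + 1) * alphaSeq N n p s * betaSeq N n p s := rfl
  have hT' : dropSeq N n p (s + 1) = rate (weight N p) (s + 1) (n + 1) *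
    alphaSeq N n p (s + 1) * betaSeq N n p (s + 1) := rfl
  rw [ht] at l2' hc hbs
  set t := p / (p - 1)
  constructor
  · exact_mod_cast (by omega : 0 < s)
  · exact_mod_cast hs
  · exact_mod_cast hns.trans hs.le
  · exact div_neg_of_pos_of_neg hp0 (by linarith)
  · exact he
  · exact gSeq_pos hp0 hp1 hns hs.le
  · positivity
  · positivity
  · exact he'
  · exact dropSeq_pos hp0 hp1 hns' hs'
  · rw [gSeq]
    field_simp
  · rw [gSeq]
    rw [hb] at l1'
    field_simp
    linear_combination l1'
  · field_simp
    linear_combination eSeq N n p s * l2' + alphaSeq N n p (s + 1) * hc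
  · rw [gSeq, sub_add_cancel]
    rw [hb, hb'] at hbs
    field_simp
    linear_combination betaSeq N n p s * betaSeq N n p (s + 1) * hbs -
      t * alphaSeq N n p s * betaSeq N n p (s + 1) * hT -
      (-1) * alphaSeq N n p (s + 1) * betaSeq N n p s * hT'
  · rw [hT']
    field_simp
    linear_combination her

end

end Krawtchouk

end

/-! ### Moment determinants as sums over configurations. -/

section

open Polynomial Finset

namespace TruncatedWeight

variable {w : ℕ → ℝ} {s k n : ℕ}

/-- The contribution of the tuple of nodes `r` to the moment determinant. -/
noncomputable def tupleWeight (w : ℕ → ℝ) (r : Fin k → ℕ) : ℝ :=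
  (∏ i, w (r i)) * (Matrix.vandermonde fun i => (r i : ℝ)).det ^ 2

lemma det_vandermonde_perm (r : Fin k → ℕ) (σ : Equiv.Perm (Fin k)) :
    (Matrix.vandermonde fun i => (r (σ i) : ℝ)).det =
      (Equiv.Perm.sign σ : ℤ) * (Matrix.vandermonde fun i => (r i : ℝ)).det := by
  rw [← Matrix.det_permute]
  rfl

lemma tupleWeight_perm (w : ℕ → ℝ) (r : Fin k → ℕ) (σ : Equiv.Perm (Fin k)) :
    tupleWeight w (fun i => r (σ i)) = tupleWeight w r := by
  rw [tupleWeight, det_vandermonde_perm, mul_pow, tupleWeight,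
    Equiv.prod_comp σ fun i => w (r i)]
  have : ((Equiv.Perm.sign σ : ℤ) : ℝ) ^ 2 = 1 := by
    rcases Int.units_eq_one_or (Equiv.Perm.sign σ) with h | h <;> simp [h]
  rw [this, one_mul]

/-- Each row is a sum over nodes, so multilinearity expands the determinant over tuples of nodes. -/
lemma det_momentMatrix_eq_sum_pi (w : ℕ → ℝ) (s k : ℕ) :
    (momentMatrix w s k).det = ∑ r ∈ Fintype.piFinset fun _ : Fin k => range s,
      (∏ i, w (r i) * (r i : ℝ) ^ (i : ℕ)) * (Matrix.vandermonde fun i => (r i : ℝ)).det := by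
  have h : momentMatrix w s k = Matrix.of fun i : Fin k => ∑ x ∈ range s,
      fun j : Fin k => (w x * (x : ℝ) ^ (i : ℕ)) * (x : ℝ) ^ (j : ℕ) := by
    ext i j
    simp [momentMatrix, pairing_apply, mul_assoc]
  rw [h]
  refine ((Matrix.detRowAlternating (n := Fin k) (R := ℝ)).toMultilinearMap.map_sum_finset
    (fun i x (j : Fin k) => (w x * (x : ℝ) ^ (i : ℕ)) * (x : ℝ) ^ (j : ℕ))
    (fun _ => range s)).trans ?_
  refine sum_congr rfl fun r _ => ?_
  rw [← Matrix.det_mul_column]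
  rfl

/-- Relabelling a tuple by `σ` multiplies its Vandermonde determinant by the sign of `σ`; summing
over all `σ` turns the product of powers into a second Vandermonde determinant. -/
lemma factorial_mul_det_momentMatrix (w : ℕ → ℝ) (s k : ℕ) :
    (k.factorial : ℝ) * (momentMatrix w s k).det =
      ∑ r ∈ Fintype.piFinset fun _ : Fin k => range s, tupleWeight w r := by
  have h1 : ∀ σ : Equiv.Perm (Fin k), (momentMatrix w s k).det =
      ∑ r ∈ Fintype.piFinset fun _ : Fin k => range s,
        (∏ i, w (r i)) * (Matrix.vandermonde fun i => (r i : ℝ)).det *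
          ((Equiv.Perm.sign σ : ℤ) * ∏ i, (r (σ i) : ℝ) ^ (i : ℕ)) := by
    intro σ
    rw [det_momentMatrix_eq_sum_pi]
    refine (sum_bij' (fun r _ i => r (σ i)) (fun r _ i => r (σ.symm i)) ?_ ?_ ?_ ?_ ?_).symm
    · intro r hr
      simp only [Fintype.mem_piFinset] at hr ⊢
      exact fun i => hr _
    · intro r hr
      simp only [Fintype.mem_piFinset] at hr ⊢
      exact fun i => hr _
    · intro r _
      simp
    · intro r _
      simp
    · intro r _
      rw [prod_mul_distrib, det_vandermonde_perm, Equiv.prod_comp σ fun i => w (r i)]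
      ring
  have h2 : (k.factorial : ℝ) * (momentMatrix w s k).det =
      ∑ _σ : Equiv.Perm (Fin k), (momentMatrix w s k).det := by
    rw [sum_const, card_univ, Fintype.card_perm, Fintype.card_fin, nsmul_eq_mul]
  rw [h2, sum_congr rfl fun σ _ => h1 σ, sum_comm]
  refine sum_congr rfl fun r _ => ?_
  rw [← mul_sum, tupleWeight, sq, mul_assoc]
  nth_rewrite 3 [Matrix.det_apply']
  rfl

/-- The contribution of the set of nodes `S` to the moment determinant. -/
noncomputable def setWeight (w : ℕ → ℝ) (S : Finset ℕ) : ℝ :=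
  (∏ x ∈ S, ∏ y ∈ S with x < y, ((x : ℝ) - (y : ℝ)) ^ 2) * ∏ x ∈ S, w x

lemma setWeight_eq_tupleWeight (w : ℕ → ℝ) {S : Finset ℕ} (hS : S.card = k) :
    setWeight w S = tupleWeight w (S.orderEmbOfFin hS) := by
  have hmap : S = univ.map (S.orderEmbOfFin hS).toEmbedding := (S.map_orderEmbOfFin_univ hS).symm
  have hf : ∀ i, ({y ∈ S | S.orderEmbOfFin hS i < y} : Finset ℕ) =
      (Ioi i).map (S.orderEmbOfFin hS).toEmbedding := by
    intro i
    ext y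
    simp only [mem_filter, mem_map, mem_Ioi, RelEmbedding.coe_toEmbedding]
    constructor
    · rintro ⟨hy, hi⟩
      have : y ∈ Set.range (S.orderEmbOfFin hS) := by
        rw [range_orderEmbOfFin]
        exact hy
      obtain ⟨j, rfl⟩ := this
      exact ⟨j, (S.orderEmbOfFin hS).lt_iff_lt.1 hi, rfl⟩
    · rintro ⟨j, hj, rfl⟩
      exact ⟨S.orderEmbOfFin_mem hS j, (S.orderEmbOfFin hS).lt_iff_lt.2 hj⟩
  have hprod : ∀ φ : ℕ → ℝ, ∏ x ∈ S, φ x = ∏ i, φ (S.orderEmbOfFin hS i) := by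
    intro φ
    conv_lhs => rw [hmap, prod_map]
    rfl
  rw [setWeight, tupleWeight, hprod, hprod, Matrix.det_vandermonde, mul_comm, ← prod_pow]
  congr 1
  refine prod_congr rfl fun i _ => ?_
  rw [hf, prod_map, ← prod_pow]
  refine prod_congr rfl fun j _ => ?_
  rw [← neg_sub, neg_sq]
  rfl

/-- Tuples with a repeated node have zero Vandermonde determinant; the others are a set together
with a permutation of its increasing enumeration. -/
lemma sum_tupleWeight (w : ℕ → ℝ) (s k : ℕ) :
    ∑ r ∈ Fintype.piFinset fun _ : Fin k => range s, tupleWeight w r =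
      (k.factorial : ℝ) * ∑ S ∈ (range s).powersetCard k, setWeight w S := by
  classical
  have h0 : ∑ r ∈ Fintype.piFinset fun _ : Fin k => range s, tupleWeight w r =
      ∑ r ∈ (Fintype.piFinset fun _ : Fin k => range s) with Function.Injective r,
        tupleWeight w r := by
    refine (sum_filter_of_ne fun r _ hr => ?_).symm
    have h1 : (Matrix.vandermonde fun i => (r i : ℝ)).det ≠ 0 := fun h => hr (by
      rw [tupleWeight, h]
      simp)
    have := Matrix.det_vandermonde_ne_zero_iff.1 h1
    exact fun i j hij => this (by simp [hij])
  have h2 : (k.factorial : ℝ) * ∑ S ∈ (range s).powersetCard k, setWeight w S =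
      ∑ q ∈ ((range s).powersetCard k) ×ˢ (univ : Finset (Equiv.Perm (Fin k))),
        setWeight w q.1 := by
    rw [sum_product, mul_sum]
    refine sum_congr rfl fun S _ => ?_
    change _ = ∑ _σ : Equiv.Perm (Fin k), setWeight w S
    rw [sum_const, card_univ, Fintype.card_perm, Fintype.card_fin, nsmul_eq_mul]
  rw [h0, h2]
  symm
  refine sum_bij (fun q hq i => q.1.orderEmbOfFin
    (mem_powersetCard.1 (mem_product.1 hq).1).2 (q.2 i)) ?_ ?_ ?_ ?_
  · rintro ⟨S, σ⟩ hq
    have hS := mem_powersetCard.1 (mem_product.1 hq).1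
    simp only [mem_filter, Fintype.mem_piFinset]
    exact ⟨fun i => hS.1 (S.orderEmbOfFin_mem hS.2 _),
      (S.orderEmbOfFin hS.2).injective.comp σ.injective⟩
  · rintro ⟨S, σ⟩ hq ⟨S', σ'⟩ hq' h
    have hS := mem_powersetCard.1 (mem_product.1 hq).1
    have hS' := mem_powersetCard.1 (mem_product.1 hq').1
    have hSS : S = S' := by
      have h3 : ∀ (U : Finset ℕ) (hU : U.card = k) (ρ : Equiv.Perm (Fin k)),
          Set.range (fun i => U.orderEmbOfFin hU (ρ i)) = U := by
        intro U hU ρ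
        rw [← range_orderEmbOfFin U hU]
        exact ρ.surjective.range_comp (U.orderEmbOfFin hU)
      rw [← Finset.coe_inj, ← h3 S hS.2 σ, ← h3 S' hS'.2 σ']
      exact congrArg Set.range h
    subst hSS
    have : σ = σ' := Equiv.ext fun i => (S.orderEmbOfFin hS.2).injective (congrFun h i)
    rw [this]
  · intro r hr
    simp only [mem_filter, Fintype.mem_piFinset] at hr
    have hcard : (univ.image r).card = k := by
      rw [card_image_of_injective _ hr.2, card_univ, Fintype.card_fin]
    have hmono : StrictMono (r ∘ Tuple.sort r) :=
      (Tuple.monotone_sort r).strictMono_of_injective (hr.2.comp (Tuple.sort r).injective)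
    have hu := orderEmbOfFin_unique hcard (f := r ∘ Tuple.sort r)
      (fun i => mem_image_of_mem _ (mem_univ _)) hmono
    -- Sorting `r` gives the increasing enumeration of its image, so the inverse of the sorting
    -- permutation recovers `r`.
    refine ⟨(univ.image r, (Tuple.sort r).symm), ?_, ?_⟩
    · simp only [mem_product, mem_powersetCard, mem_univ, and_true, hcard]
      intro x hx
      obtain ⟨i, -, rfl⟩ := mem_image.1 hx
      exact hr.1 i
    · funext i
      change (univ.image r).orderEmbOfFin hcard ((Tuple.sort r).symm i) = r i
      rw [← hu]
      simp
  · rintro ⟨S, σ⟩ hq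
    have hS := mem_powersetCard.1 (mem_product.1 hq).1
    rw [setWeight_eq_tupleWeight w hS.2]
    exact (tupleWeight_perm w (S.orderEmbOfFin hS.2) σ).symm

/-- The moment determinant as a sum over configurations of `k` nodes. -/
lemma det_momentMatrix_eq_sum (w : ℕ → ℝ) (s k : ℕ) :
    (momentMatrix w s k).det = ∑ S ∈ (range s).powersetCard k, setWeight w S := by
  have h : (k.factorial : ℝ) ≠ 0 := by exact_mod_cast k.factorial_ne_zero
  apply mul_left_cancel₀ h
  rw [factorial_mul_det_momentMatrix, sum_tupleWeight]

end TruncatedWeight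

end

/-! ### Orthogonality and norms of the Krawtchouk polynomials. -/

section

open Polynomial Finset TruncatedWeight

namespace Krawtchouk

variable {N n m : ℕ} {p : ℝ}

/-! ### Terminating hypergeometric sums -/

lemma hypergeometric_eq_sum (a c : ℕ) (b z : ℝ) :
    ordinaryHypergeometric (-(a : ℝ)) (-b) (-(c : ℝ)) z =
      ∑ j ∈ range (a + 1), (a.choose j : ℝ) * (descPochhammer ℝ j).eval b /
        (c.descFactorial j : ℝ) * (-z) ^ j := by
  rw [ordinaryHypergeometric_eq_tsum]
  dsimp only
  rw [tsum_eq_sum (s := range (a + 1))]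
  · refine sum_congr rfl fun j _ => ?_
    have h1 : ((-1 : ℝ) ^ j) * (-1) ^ j = 1 := by rw [← mul_pow]; norm_num
    have h2 : ((-1 : ℝ) ^ j)⁻¹ = (-1) ^ j := by rw [← inv_pow]; norm_num
    have h3 : (j.factorial : ℝ) ≠ 0 := by exact_mod_cast j.factorial_ne_zero
    rw [ascPochhammer_eval_neg_eq_descPochhammer, ascPochhammer_eval_neg_eq_descPochhammer,
      ascPochhammer_eval_neg_eq_descPochhammer, descPochhammer_eval_eq_descFactorial,
      descPochhammer_eval_eq_descFactorial, Nat.descFactorial_eq_factorial_mul_choose a, mul_inv, h2,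
      smul_eq_mul, neg_pow z]
    push_cast
    rw [div_eq_mul_inv]
    field_simp
    linear_combination (z ^ j * (a.choose j : ℝ) *
      (descPochhammer ℝ j).eval b / (c.descFactorial j : ℝ)) * h1
  · intro j hj
    rw [mem_range, not_lt] at hj
    rw [ascPochhammer_eval_neg_coe_nat_of_lt (by omega)]
    simp

/-! ### Krawtchouk polynomials -/

/-- The monic Krawtchouk polynomial of degree `n`. -/
noncomputable def krawtchoukPoly (N n : ℕ) (p : ℝ) : ℝ[X] :=
  ∑ j ∈ range (n + 1), C ((-1) ^ n * (N.descFactorial n : ℝ) * p ^ n *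
    ((n.choose j : ℝ) / (N.descFactorial j : ℝ) * (-(1 / p)) ^ j)) * descPochhammer ℝ j

lemma P_eq_eval (N n : ℕ) (p ζ : ℝ) : P N n p ζ = (krawtchoukPoly N n p).eval ζ := by
  rw [P, K, hypergeometric_eq_sum, ascPochhammer_eval_neg_eq_descPochhammer,
    descPochhammer_eval_eq_descFactorial, krawtchoukPoly, eval_finsetSum, mul_sum]
  refine sum_congr rfl fun j _ => ?_
  rw [eval_mul, eval_C]
  ring

lemma degLT_sub_X_pow_of_monic {f : ℝ[X]} (hf : f.Monic) (hn : f.natDegree = n) :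
    DegLT (f - X ^ n) n := by
  rw [degLT_iff]
  intro m hm
  rcases hm.eq_or_lt with rfl | hm
  · rw [coeff_sub, coeff_X_pow_self, ← hn, hf.coeff_natDegree, sub_self]
  · rw [coeff_sub, coeff_X_pow, if_neg (by omega), coeff_eq_zero_of_natDegree_lt (by omega), sub_zero]

lemma descPochhammer_sub_X_pow (n : ℕ) : DegLT (descPochhammer ℝ n - X ^ n) n :=
  degLT_sub_X_pow_of_monic (monic_descPochhammer ℝ n) (descPochhammer_natDegree ℝ n)

lemma krawtchoukPoly_sub_X_pow (hp0 : 0 < p) (hnN : n ≤ N) :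
    DegLT (krawtchoukPoly N n p - X ^ n) n := by
  have h1 : (N.descFactorial n : ℝ) ≠ 0 := by
    exact_mod_cast (Nat.descFactorial_pos.2 hnN).ne'
  have h2 : (-1 : ℝ) ^ n * (N.descFactorial n : ℝ) * p ^ n *
      ((n.choose n : ℝ) / (N.descFactorial n : ℝ) * (-(1 / p)) ^ n) = 1 := by
    rw [Nat.choose_self, neg_pow (1 / p), one_div, inv_pow]
    have h3 : ((-1 : ℝ) ^ n) * (-1) ^ n = 1 := by rw [← mul_pow]; norm_num
    field_simp
    linear_combination h3
  rw [krawtchoukPoly, sum_range_succ, h2, C_1, one_mul, add_sub_assoc]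
  refine degree_add_lt' ?_ (descPochhammer_sub_X_pow n)
  refine (degree_sum_le _ _).trans_lt ((Finset.sup_lt_iff (WithBot.bot_lt_coe n)).2 fun j hj => ?_)
  refine degree_C_mul_lt _ ?_
  exact (degree_le_natDegree.trans_eq (by rw [descPochhammer_natDegree])).trans_lt
    (Nat.cast_lt.2 (mem_range.1 hj))

lemma sum_weight_descFactorial_right (p : ℝ) (m : ℕ) : ∀ N : ℕ,
    ∑ x ∈ range (N + 1), weight N p x * ((N - x).descFactorial m : ℝ) =
      (N.descFactorial m : ℝ) * (1 - p) ^ m := by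
  induction m with
  | zero =>
    intro N
    have h := add_pow p (1 - p) N
    rw [add_sub_cancel, one_pow] at h
    simp only [Nat.descFactorial_zero, Nat.cast_one, mul_one, pow_zero]
    refine Eq.trans (sum_congr rfl fun x _ => ?_) h.symm
    rw [weight]
    ring
  | succ m ih =>
    rintro (_ | N)
    · simp
    · rw [sum_range_succ, Nat.sub_self, Nat.zero_descFactorial_succ, Nat.cast_zero, mul_zero,
        add_zero, Nat.succ_descFactorial_succ]
      push_cast
      have h : ∀ x ∈ range (N + 1), weight (N + 1) p x * ((N + 1 - x).descFactorial (m + 1) : ℝ) =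
          (N + 1) * (1 - p) * (weight N p x * ((N - x).descFactorial m : ℝ)) := by
        intro x hx
        have hxN : x ≤ N := Nat.lt_succ_iff.1 (mem_range.1 hx)
        have hc := Nat.choose_mul_succ_eq N x
        rw [Nat.succ_sub hxN] at hc ⊢
        have hc' : (N.choose x : ℝ) * (N + 1) = (N + 1).choose x * ((N - x : ℕ) + 1) := by
          exact_mod_cast hc
        rw [Nat.succ_descFactorial_succ, weight, weight, Nat.succ_sub hxN]
        push_cast
        rw [pow_succ]
        linear_combination -(p ^ x * (1 - p) ^ (N - x) * (1 - p) *
          ((N - x).descFactorial m : ℝ)) * hc'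
      rw [sum_congr rfl h, ← mul_sum, ih]
      ring

/-- Mixed factorial moments of the binomial law: absorbing one factor of `x` lowers both `N` and `x`
by one. -/
lemma sum_weight_descFactorial (p : ℝ) (m j : ℕ) : ∀ N : ℕ,
    ∑ x ∈ range (N + 1), weight N p x *
        ((x.descFactorial j : ℝ) * ((N - x).descFactorial m : ℝ)) =
      (N.descFactorial (j + m) : ℝ) * p ^ j * (1 - p) ^ m := by
  induction j with
  | zero =>
    intro N
    simpa using sum_weight_descFactorial_right p m N
  | succ j ih =>
    rintro (_ | N)
    · simp [Nat.succ_add]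
    · rw [sum_range_succ', Nat.zero_descFactorial_succ, Nat.cast_zero, zero_mul, mul_zero, add_zero,
        Nat.succ_add, Nat.succ_descFactorial_succ]
      have h : ∀ x ∈ range (N + 1), weight (N + 1) p (x + 1) *
          (((x + 1).descFactorial (j + 1) : ℝ) * ((N + 1 - (x + 1)).descFactorial m : ℝ)) =
          (N + 1) * p * (weight N p x * ((x.descFactorial j : ℝ) *
            ((N - x).descFactorial m : ℝ))) := by
        intro x _
        have hc : ((N : ℝ) + 1) * N.choose x = (N + 1).choose (x + 1) * (x + 1) := by
          exact_mod_cast Nat.add_one_mul_choose_eq N x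
        rw [Nat.succ_descFactorial_succ, weight, weight, Nat.add_sub_add_right]
        push_cast
        rw [pow_succ]
        linear_combination -(p ^ x * p * (1 - p) ^ (N - x) * (x.descFactorial j : ℝ) *
          ((N - x).descFactorial m : ℝ)) * hc
      rw [sum_congr rfl h, ← mul_sum, ih]
      push_cast
      ring

lemma sum_alternating_descFactorial (hnN : n ≤ N) (f : ℝ[X]) :
    ∑ j ∈ range (n + 1), (-1 : ℝ) ^ j * (n.choose j : ℝ) * f.eval (((N - j : ℕ) : ℝ)) =
      (fwdDiff (1 : ℝ))^[n] f.eval ((N - n : ℕ) : ℝ) := by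
  rw [fwdDiff_iter_eq_sum_shift, ← sum_range_reflect]
  refine sum_congr rfl fun j hj => ?_
  have hj' : j ≤ n := Nat.lt_succ_iff.1 (mem_range.1 hj)
  rw [Nat.add_sub_cancel, Nat.choose_symm hj']
  have h : ((N - (n - j) : ℕ) : ℝ) = ((N - n : ℕ) : ℝ) + j := by
    have : N - (n - j) = N - n + j := by omega
    exact_mod_cast this
  rw [h]
  simp

/-- The monic polynomial with the zeros `N, N - 1, …, N - m + 1`. -/
noncomputable def topPoly (N m : ℕ) : ℝ[X] := ∏ i ∈ range m, (X - C ((N : ℝ) - i))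

lemma topPoly_sub_X_pow (N m : ℕ) : DegLT (topPoly N m - X ^ m) m :=
  degLT_sub_X_pow_of_monic (monic_prod_X_sub_C _ _) (by
    rw [topPoly, natDegree_prod_of_monic _ _ fun i _ => monic_X_sub_C _]
    simp only [natDegree_X_sub_C]
    simp)

lemma topPoly_eval {x : ℕ} (hx : x ≤ N) (m : ℕ) :
    (topPoly N m).eval (x : ℝ) = (-1) ^ m * ((N - x).descFactorial m : ℝ) := by
  rw [← descPochhammer_eval_eq_descFactorial, descPochhammer_eval_eq_prod_range, topPoly,
    eval_prod, Nat.cast_sub hx]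
  have : ((-1 : ℝ)) ^ m = ∏ _i ∈ range m, (-1 : ℝ) := by simp
  rw [this, ← prod_mul_distrib]
  refine prod_congr rfl fun i _ => ?_
  simp
  ring

/-- Falling factorials in `x` against those in `N - x` have closed moments, in which the powers of
`1 / p` cancel. What remains is an `n`-th difference of a polynomial of degree `m`: zero for `m <
n`, and `n!` for `m = n`. -/
lemma pairing_krawtchoukPoly_topPoly (hp0 : 0 < p) (hnN : n ≤ N) (m : ℕ) :
    pairing (weight N p) (N + 1) (krawtchoukPoly N n p * topPoly N m) =
      (-1) ^ (n + m) * (N.descFactorial n : ℝ) * p ^ n * (1 - p) ^ m *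
        (fwdDiff (1 : ℝ))^[n] (descPochhammer ℝ m).eval ((N - n : ℕ) : ℝ) := by
  rw [← sum_alternating_descFactorial hnN, mul_sum, pairing_apply]
  have h1 : ∀ x ∈ range (N + 1),
      weight N p x * (krawtchoukPoly N n p * topPoly N m).eval (x : ℝ) =
        ∑ j ∈ range (n + 1), (-1) ^ n * (N.descFactorial n : ℝ) * p ^ n *
          ((n.choose j : ℝ) / (N.descFactorial j : ℝ) * (-(1 / p)) ^ j) * (-1) ^ m *
          (weight N p x * ((x.descFactorial j : ℝ) * ((N - x).descFactorial m : ℝ))) := by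
    intro x hx
    rw [eval_mul, topPoly_eval (Nat.lt_succ_iff.1 (mem_range.1 hx)), krawtchoukPoly,
      eval_finsetSum, sum_mul, mul_sum]
    refine sum_congr rfl fun j _ => ?_
    rw [eval_mul, eval_C, descPochhammer_eval_eq_descFactorial]
    ring
  rw [sum_congr rfl h1, sum_comm]
  refine sum_congr rfl fun j hj => ?_
  have hjn : j ≤ n := Nat.lt_succ_iff.1 (mem_range.1 hj)
  have h2 : (N.descFactorial (j + m) : ℝ) =
      (N - j).descFactorial m * N.descFactorial j := by
    have := Nat.descFactorial_mul_descFactorial (n := N) (m := j + m) (k := j) (by omega)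
    rw [Nat.add_sub_cancel_left] at this
    exact_mod_cast this.symm
  have h3 : (N.descFactorial j : ℝ) ≠ 0 := by
    exact_mod_cast (Nat.descFactorial_pos.2 (hjn.trans hnN)).ne'
  rw [← mul_sum, sum_weight_descFactorial, h2, descPochhammer_eval_eq_descFactorial,
    neg_pow (1 / p), one_div, inv_pow, pow_add]
  field_simp

lemma linearMap_eq_zero_of_basis (φ : ℝ[X] →ₗ[ℝ] ℝ) {R : ℕ → ℝ[X]}
    (hR : ∀ m, DegLT (R m - X ^ m) m) : ∀ n : ℕ, (∀ m < n, φ (R m) = 0) →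
      ∀ q : ℝ[X], DegLT q n → φ q = 0 := by
  intro n
  induction n with
  | zero =>
    intro _ q hq
    have : q = 0 := by
      ext m
      exact degLT_iff.1 hq m m.zero_le
    rw [this, map_zero]
  | succ n ih =>
    intro h q hq
    have h1 : DegLT (q - C (q.coeff n) * R n) n := by
      have : q - C (q.coeff n) * R n =
          q - C (q.coeff n) * X ^ n - C (q.coeff n) * (R n - X ^ n) := by ring
      rw [this]
      exact degree_sub_lt' (degree_sub_leading_lt hq) (degree_C_mul_lt _ (hR n))
    have h2 := ih (fun m hm => h m (by omega)) _ h1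
    rw [map_sub, ← smul_eq_C_mul, map_smul, h n (by omega), smul_zero, sub_zero] at h2
    exact h2

lemma pairing_krawtchoukPoly_mul (hp0 : 0 < p) (hnN : n ≤ N) {q : ℝ[X]} (hq : DegLT q n) :
    pairing (weight N p) (N + 1) (krawtchoukPoly N n p * q) = 0 := by
  refine linearMap_eq_zero_of_basis
    ((pairing (weight N p) (N + 1)).comp (LinearMap.mulLeft ℝ (krawtchoukPoly N n p)))
    (topPoly_sub_X_pow N) n (fun m hm => ?_) q hq
  simp only [LinearMap.comp_apply, LinearMap.mulLeft_apply]
  rw [pairing_krawtchoukPoly_topPoly hp0 hnN,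
    Polynomial.fwdDiff_iter_eq_zero_of_degree_lt (by rwa [descPochhammer_natDegree])]
  simp

lemma normSq_eq (hp0 : 0 < p) (hnN : n ≤ N) :
    normSq N n p = n.factorial * (N.descFactorial n : ℝ) * p ^ n * (1 - p) ^ n := by
  have h1 : normSq N n p =
      pairing (weight N p) (N + 1) (krawtchoukPoly N n p * krawtchoukPoly N n p) := by
    rw [normSq, pairing_apply]
    refine sum_congr rfl fun x _ => ?_
    rw [P_eq_eval, eval_mul]
    ring
  have h2 := pairing_krawtchoukPoly_mul hp0 hnN
    (degLT_sub_of_sub_X_pow (krawtchoukPoly_sub_X_pow hp0 hnN) (topPoly_sub_X_pow N n))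
  have h3 := Polynomial.fwdDiff_iter_degree_eq_factorial (descPochhammer ℝ n)
  rw [descPochhammer_natDegree, (monic_descPochhammer ℝ n).leadingCoeff] at h3
  have h4 : ((-1 : ℝ) ^ n) * (-1) ^ n = 1 := by rw [← mul_pow]; norm_num
  rw [mul_sub, map_sub, sub_eq_zero] at h2
  rw [h1, h2, pairing_krawtchoukPoly_topPoly hp0 hnN, h3, pow_add, h4]
  simp
  ring

lemma normSq_pos (hp0 : 0 < p) (hp1 : p < 1) (hnN : n ≤ N) : 0 < normSq N n p := by
  rw [normSq_eq hp0 hnN]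
  have h2 : (0 : ℝ) < N.descFactorial n := by exact_mod_cast Nat.descFactorial_pos.2 hnN
  positivity

end Krawtchouk

end

/-! ### Fredholm determinants and gap probabilities as ratios of moment determinants. -/

section

open Polynomial Finset TruncatedWeight

namespace TruncatedWeight

variable {w : ℕ → ℝ} {s k : ℕ}

lemma reproKernel_eval (w : ℕ → ℝ) (s k : ℕ) (x y : ℝ) :
    (reproKernel w s k y).eval x =
      ∑ i : Fin k, ∑ j : Fin k, x ^ (i : ℕ) * (momentMatrix w s k)⁻¹ i j * y ^ (j : ℕ) := by
  rw [reproKernel, dualPoly, ← leval_apply, linearMap_ext_ofCoeffs]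
  simp only [leval_apply, eval_pow, eval_X, Matrix.mulVec, dotProduct, sum_mul]
  exact sum_congr rfl fun i _ => sum_congr rfl fun j _ => by ring

/-- The Fredholm determinant of the reproducing kernel on the complement of `{0, …, s - 1}`. -/
lemma det_one_sub_kernel {M : ℕ} (hw : ∀ x < M, 0 < w x) (hkM : k ≤ M) (T : Finset ℕ)
    (hT : Disjoint (range s) T) (hM : range s ∪ T = range M) :
    (1 - Matrix.of fun x y : T => √(w x) * √(w y) * (reproKernel w M k (y : ℕ)).eval ((x : ℕ) : ℝ)).det
      = (momentMatrix w s k).det / (momentMatrix w M k).det := by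
  have hdet := det_momentMatrix_ne_zero hw hkM
  set A : Matrix T (Fin k) ℝ := Matrix.of fun x i => √(w x) * ((x : ℕ) : ℝ) ^ (i : ℕ) with hA
  -- The kernel factors through the `k`-dimensional polynomial space, so Sylvester's identity
  -- reduces the determinant to size `k`.
  have h1 : (Matrix.of fun x y : T =>
      √(w x) * √(w y) * (reproKernel w M k (y : ℕ)).eval ((x : ℕ) : ℝ)) =
      A * ((momentMatrix w M k)⁻¹ * A.transpose) := by
    ext x y
    simp only [Matrix.of_apply, reproKernel_eval, Matrix.mul_apply, Matrix.transpose_apply, hA,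
      mul_sum]
    exact sum_congr rfl fun i _ => sum_congr rfl fun j _ => by ring
  -- The Gram matrix of the removed nodes is the difference of the two moment matrices.
  have h2 : A.transpose * A = momentMatrix w M k - momentMatrix w s k := by
    ext i j
    have hs : ∀ q : ℝ[X], pairing w M q = pairing w s q + ∑ x ∈ T, w x * q.eval (x : ℝ) := by
      intro q
      rw [pairing_apply, pairing_apply, ← hM, sum_union hT]
    simp only [Matrix.mul_apply, Matrix.transpose_apply, hA, Matrix.of_apply, Matrix.sub_apply,
      momentMatrix, hs, add_sub_cancel_left]
    rw [← sum_coe_sort T]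
    refine sum_congr rfl fun x _ => ?_
    have hx : (x : ℕ) < M := by
      rw [← mem_range, ← hM]
      exact mem_union_right _ x.2
    have := Real.mul_self_sqrt (hw x hx).le
    simp only [eval_mul, eval_pow, eval_X]
    linear_combination ((x : ℕ) : ℝ) ^ (i : ℕ) * ((x : ℕ) : ℝ) ^ (j : ℕ) * this
  have h3 : (1 : Matrix (Fin k) (Fin k) ℝ) - (momentMatrix w M k)⁻¹ * A.transpose * A =
      (momentMatrix w M k)⁻¹ * momentMatrix w s k := by
    rw [Matrix.mul_assoc, h2, Matrix.mul_sub, Matrix.nonsing_inv_mul _ hdet.isUnit, sub_sub_cancel]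
  rw [h1, Matrix.det_one_sub_mul_comm, h3, Matrix.det_mul, Matrix.det_nonsing_inv,
    Ring.inverse_eq_inv', mul_comm, div_eq_mul_inv]

lemma det_momentMatrix_eq_prod {R : ℕ → ℝ[X]} (hmonic : ∀ j < k, (R j).Monic)
    (hdeg : ∀ j < k, (R j).natDegree = j)
    (horth : ∀ i < k, ∀ j < k, i ≠ j → pairing w s (R i * R j) = 0) :
    (momentMatrix w s k).det = ∏ j ∈ range k, pairing w s (R j * R j) := by
  set B : Matrix (Fin k) (Fin k) ℝ := Matrix.of fun i j => (R j).coeff i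
  have hB1 : B.det = 1 := Matrix.det_matrixOfPolynomials (fun j : Fin k => R j)
    (fun j => hdeg j j.2) (fun j => hmonic j j.2)
  have hR : ∀ j : Fin k, R j = ofCoeffs fun i : Fin k => B i j := by
    intro j
    refine (ofCoeffs_coeff ?_).symm
    exact (degree_le_natDegree.trans_eq (by rw [hdeg j j.2])).trans_lt (Nat.cast_lt.2 j.2)
  have h : B.transpose * momentMatrix w s k * B =
      Matrix.diagonal fun j : Fin k => pairing w s (R j * R j) := by
    ext i j
    have h1 : (B.transpose * momentMatrix w s k * B) i j = pairing w s (R i * R j) := by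
      rw [Matrix.mul_assoc, hR j]
      have h2 : ∀ a : Fin k, pairing w s (X ^ (a : ℕ) * ofCoeffs fun i => B i j) =
          (momentMatrix w s k * B) a j := fun a => by
        rw [mul_comm, pairing_ofCoeffs_mul_X_pow]
        rfl
      have h3 := linearMap_ext_ofCoeffs ((pairing w s).comp
        (LinearMap.mulRight ℝ (ofCoeffs fun i => B i j))) fun a : Fin k => B a i
      simp only [LinearMap.comp_apply, LinearMap.mulRight_apply, h2] at h3
      rw [hR i, h3, Matrix.mul_apply]
      rfl
    rw [h1, Matrix.diagonal_apply]
    split_ifs with hij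
    · rw [hij]
    · exact horth i i.2 j j.2 fun h => hij (Fin.ext h)
  have h4 := congrArg Matrix.det h
  rw [Matrix.det_mul, Matrix.det_mul, Matrix.det_transpose, hB1, Matrix.det_diagonal,
    one_mul, mul_one] at h4
  rw [h4, Fin.prod_univ_eq_prod_range fun j => pairing w s (R j * R j)]

lemma prod_factorial_eq_superFactorial (n : ℕ) :
    ∏ j ∈ range (n + 1), j.factorial = n.superFactorial := by
  induction n with
  | zero => simp
  | succ n ih => rw [prod_range_succ, ih, Nat.superFactorial, mul_comm]

/-- With as many nodes as powers, the moment matrix is `Vᵀ diag(w) V` for a square Vandermonde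
matrix. -/
lemma det_momentMatrix_self (w : ℕ → ℝ) (n : ℕ) :
    (momentMatrix w (n + 1) (n + 1)).det =
      ∏ j ∈ range (n + 1), (j.factorial : ℝ) ^ 2 * w j := by
  have h : momentMatrix w (n + 1) (n + 1) =
      (Matrix.vandermonde fun i : Fin (n + 1) => ((i : ℕ) : ℝ)).transpose *
        Matrix.diagonal (fun i : Fin (n + 1) => w i) *
        Matrix.vandermonde fun i : Fin (n + 1) => ((i : ℕ) : ℝ) := by
    ext i j
    rw [Matrix.mul_apply]
    simp only [Matrix.mul_diagonal, Matrix.transpose_apply, Matrix.vandermonde_apply, momentMatrix,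
      Matrix.of_apply, pairing_apply, eval_mul, eval_pow, eval_X]
    rw [← Fin.sum_univ_eq_sum_range fun x => w x * ((x : ℝ) ^ (i : ℕ) * (x : ℝ) ^ (j : ℕ))]
    exact sum_congr rfl fun x _ => by ring
  rw [h, Matrix.det_mul, Matrix.det_mul, Matrix.det_transpose, Matrix.det_diagonal,
    Matrix.det_vandermonde_id_eq_superFactorial, ← prod_factorial_eq_superFactorial,
    prod_mul_distrib, prod_pow, Fin.prod_univ_eq_prod_range fun x => w x]
  push_cast
  ring

end TruncatedWeight

namespace Krawtchouk

variable {N n m k s : ℕ} {p : ℝ}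

lemma monic_of_sub_X_pow {f : ℝ[X]} (hf : DegLT (f - X ^ n) n) : f.Monic ∧ f.natDegree = n := by
  have h1 := coeff_of_sub_X_pow hf
  have h2 : f.natDegree = n := by
    refine le_antisymm ?_ (le_natDegree_of_ne_zero (by rw [h1]; exact one_ne_zero))
    exact natDegree_le_iff_coeff_eq_zero.2 fun m hm =>
      degLT_iff.1 (degLT_of_sub_X_pow hf) m hm
  exact ⟨by rw [Monic, leadingCoeff, h2, h1], h2⟩

lemma pairing_krawtchoukPoly_self (N n : ℕ) (p : ℝ) :
    pairing (weight N p) (N + 1) (krawtchoukPoly N n p * krawtchoukPoly N n p) = normSq N n p := by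
  rw [normSq, pairing_apply]
  refine sum_congr rfl fun x _ => ?_
  rw [P_eq_eval, eval_mul]
  ring

lemma gapProb_eq_div (k : ℕ) (hs : s ≤ N + 1) :
    gapProb N k p s = (momentMatrix (weight N p) s k).det /
      (momentMatrix (weight N p) (N + 1) k).det := by
  rw [det_momentMatrix_eq_sum, det_momentMatrix_eq_sum, gapProb]
  have h : {S ∈ (range (N + 1)).powersetCard k | Disjoint S (Icc s N)} =
      (range s).powersetCard k := by
    ext S
    simp only [mem_filter, mem_powersetCard, disjoint_left, subset_iff, mem_range, mem_Icc, not_and,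
      not_le]
    constructor
    · rintro ⟨⟨h1, h2⟩, h3⟩
      refine ⟨fun x hx => ?_, h2⟩
      by_contra! h4
      have := h1 hx
      have := h3 hx h4
      omega
    · rintro ⟨h1, h2⟩
      exact ⟨⟨fun x hx => (h1 hx).trans_le hs, h2⟩, fun x hx h4 => absurd (h1 hx) (by omega)⟩
  rw [h]
  rfl

section

variable (hp0 : 0 < p) (hp1 : p < 1)
include hp0 hp1

lemma orthoPoly_eq_krawtchoukPoly (hn : n ≤ N) :
    orthoPoly (weight N p) (N + 1) n = krawtchoukPoly N n p :=
  (eq_orthoPoly (weight_pos_of_lt hp0 hp1 le_rfl) (by omega) (krawtchoukPoly_sub_X_pow hp0 hn)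
    fun _ hq => pairing_krawtchoukPoly_mul hp0 hn hq).symm

lemma leadDual_eq_krawtchoukPoly (hn : n ≤ N) :
    leadDual (weight N p) (N + 1) n = C (normSq N n p)⁻¹ * krawtchoukPoly N n p := by
  have hd := krawtchoukPoly_sub_X_pow hp0 hn
  refine (eq_dualPoly (weight_pos_of_lt hp0 hp1 le_rfl) (by omega) _
    (degree_C_mul_lt _ (degLT_of_sub_X_pow hd)) fun q hq => ?_).symm
  have h1 : DegLT (q - C (q.coeff n) * krawtchoukPoly N n p) n := by
    have : q - C (q.coeff n) * krawtchoukPoly N n p =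
      q - C (q.coeff n) * X ^ n - C (q.coeff n) * (krawtchoukPoly N n p - X ^ n) := by ring
    rw [this]
    exact degree_sub_lt' (degree_sub_leading_lt hq) (degree_C_mul_lt _ hd)
  have h2 := pairing_krawtchoukPoly_mul hp0 hn h1
  rw [mul_sub, map_sub, mul_left_comm, pairing_C_mul, pairing_krawtchoukPoly_self,
    sub_eq_zero] at h2
  have := (normSq_pos hp0 hp1 hn).ne'
  rw [mul_assoc, pairing_C_mul, h2, lcoeff_apply]
  field_simp

lemma kernel_eq (hn : n + 1 ≤ N) {x y : ℕ} (hx : x ≤ N) (hy : y ≤ N) :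
    kernel N (n + 1) p x y = √(weight N p x) * √(weight N p y) *
      (reproKernel (weight N p) (N + 1) (n + 1) y).eval (x : ℝ) := by
  have hw := weight_pos_of_lt hp0 hp1 (le_refl N)
  have hu := orthoPoly_eq_krawtchoukPoly hp0 hp1 hn
  have hv := leadDual_eq_krawtchoukPoly hp0 hp1 (show n ≤ N by omega)
  have hP : ∀ m, P N m p = fun ζ => (krawtchoukPoly N m p).eval ζ :=
    fun m => funext fun ζ => P_eq_eval N m p ζ
  rw [kernel]
  split_ifs with hxy
  · subst hxy
    rw [reproKernel_eval_self hw (by omega), hu, hv, Real.mul_self_sqrt (weight_pos hp0 hp1 hx).le,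
      hP, hP, Nat.add_sub_cancel]
    simp only [Polynomial.deriv, derivative_mul, derivative_C, zero_mul, zero_add, eval_mul, eval_C]
    ring
  · have h := reproKernel_eval_mul (n := n) hw (by omega) x y
    have hne : (x : ℝ) - y ≠ 0 := sub_ne_zero.2 (by exact_mod_cast hxy)
    rw [hu, hv] at h
    rw [Real.sqrt_mul (weight_pos hp0 hp1 hx).le, Nat.add_sub_cancel, P_eq_eval, P_eq_eval,
      P_eq_eval, P_eq_eval]
    rw [mul_comm, ← eq_div_iff hne] at h
    rw [h]
    simp only [eval_mul, eval_C]
    ring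

lemma D_eq_div (hn : n + 1 ≤ N) (hs : s ≤ N + 1) :
    D N (n + 1) p s = (momentMatrix (weight N p) s (n + 1)).det /
      (momentMatrix (weight N p) (N + 1) (n + 1)).det := by
  have hw := weight_pos_of_lt hp0 hp1 (le_refl N)
  rw [← det_one_sub_kernel hw (by omega) (Icc s N), D]
  · congr 2
    ext x y
    exact kernel_eq hp0 hp1 hn (mem_Icc.1 x.2).2 (mem_Icc.1 y.2).2
  · rw [disjoint_left]
    intro x hx hx'
    have := mem_range.1 hx
    have := mem_Icc.1 hx'
    omega
  · ext x
    simp only [mem_union, mem_range, mem_Icc]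
    omega

lemma D_ne_zero (hn : n + 1 ≤ N) (hns : n + 1 ≤ s) (hs : s ≤ N + 1) : D N (n + 1) p s ≠ 0 := by
  have hw := weight_pos_of_lt hp0 hp1 (le_refl N)
  rw [D_eq_div hp0 hp1 hn hs]
  exact div_ne_zero (det_momentMatrix_ne_zero (fun x hx => hw x (by omega)) hns)
    (det_momentMatrix_ne_zero hw (by omega))

lemma D_succ (hn : n + 1 ≤ N) (hns : n + 1 ≤ s) (hs : s ≤ N) :
    D N (n + 1) p (s + 1) = D N (n + 1) p s * growth (weight N p) s (n + 1) := by
  rw [D_eq_div hp0 hp1 hn (by omega), D_eq_div hp0 hp1 hn (by omega),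
    det_momentMatrix_succ (weight_pos_of_lt hp0 hp1 hs) hns]
  ring

lemma D_self (hn : n + 1 ≤ N) :
    D N (n + 1) p (n + 1) = (1 - p) ^ ((n + 1) * (N + 1 - (n + 1))) := by
  have hp : 0 < 1 - p := sub_pos.2 hp1
  have h1 : (momentMatrix (weight N p) (N + 1) (n + 1)).det =
      ∏ j ∈ range (n + 1), normSq N j p := by
    rw [det_momentMatrix_eq_prod (R := fun j => krawtchoukPoly N j p)]
    · exact prod_congr rfl fun j _ => pairing_krawtchoukPoly_self N j p
    · exact fun j hj => (monic_of_sub_X_pow (krawtchoukPoly_sub_X_pow hp0 (by omega))).1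
    · exact fun j hj => (monic_of_sub_X_pow (krawtchoukPoly_sub_X_pow hp0 (by omega))).2
    · intro i hi j hj hij
      rcases lt_or_gt_of_ne hij with h | h
      · rw [mul_comm]
        refine pairing_krawtchoukPoly_mul hp0 (by omega) ((degLT_of_sub_X_pow
          (krawtchoukPoly_sub_X_pow hp0 (by omega))).trans_le (Nat.cast_le.2 h))
      · refine pairing_krawtchoukPoly_mul hp0 (by omega) ((degLT_of_sub_X_pow
          (krawtchoukPoly_sub_X_pow hp0 (by omega))).trans_le (Nat.cast_le.2 h))
  rw [D_eq_div hp0 hp1 hn (by omega), h1, det_momentMatrix_self, ← prod_div_distrib]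
  have h2 : ∀ m, m ≤ N → ∏ j ∈ range m, (j.factorial : ℝ) ^ 2 * weight N p j / normSq N j p =
      (1 - p) ^ (m * (N + 1 - m)) := by
    intro m
    induction m with
    | zero => simp
    | succ m ih =>
      intro hm
      have hN : (N.descFactorial m : ℝ) ≠ 0 := by
        exact_mod_cast (Nat.descFactorial_pos.2 (by omega : m ≤ N)).ne'
      have hf : (m.factorial : ℝ) ≠ 0 := by exact_mod_cast m.factorial_ne_zero
      have hc : (N.descFactorial m : ℝ) = m.factorial * N.choose m := by
        exact_mod_cast Nat.descFactorial_eq_factorial_mul_choose N m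
      -- The factor of index `m` is `(1 - p) ^ (N - 2m)`; multiplying by `(1 - p) ^ m` keeps the
      -- exponent natural.
      have h3 : (m.factorial : ℝ) ^ 2 * weight N p m / normSq N m p * (1 - p) ^ m =
          (1 - p) ^ (N - m) := by
        have hC : (N.choose m : ℝ) ≠ 0 := fun h => hN (by rw [hc, h, mul_zero])
        rw [normSq_eq hp0 (by omega), weight, hc]
        field_simp
      rw [prod_range_succ, ih (by omega)]
      apply mul_right_cancel₀ (pow_ne_zero m hp.ne')
      rw [mul_assoc, h3, ← pow_add, ← pow_add]
      congr 1
      obtain ⟨d, rfl⟩ : ∃ d, N = m + d := ⟨N - m, by omega⟩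
      rw [show m + d + 1 - m = d + 1 by omega, show m + d - m = d by omega,
        show m + d + 1 - (m + 1) = d by omega]
      ring
  exact h2 (n + 1) hn

end

end Krawtchouk

end

/-! ### Initial values at `s = k`, where polynomials of degree `< k` are interpolated at the nodes.
-/

section

open Polynomial Finset TruncatedWeight

namespace TruncatedWeight

variable {w : ℕ → ℝ} {k n : ℕ}

/-- A polynomial representing a point functional on as many nodes as its degree allows is
determined pointwise. -/
lemma eval_of_pairing {r : ℝ[X]} {c : ℕ → ℝ}
    (h : ∀ f : ℝ[X], DegLT f k → pairing w k (r * f) = ∑ x ∈ range k, c x * f.eval (x : ℝ))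
    {x : ℕ} (hx : x < k) : w x * r.eval (x : ℝ) = c x := by
  -- The unnormalised Lagrange polynomial of the node `x`, of degree `k - 1`.
  set f : ℝ[X] := ∏ j ∈ (range k).erase x, (X - C (j : ℝ)) with hf
  have hd : DegLT f k := by
    have h1 : f.natDegree = ((range k).erase x).card := by
      rw [hf, natDegree_prod_of_monic _ _ fun i _ => monic_X_sub_C _]
      simp only [natDegree_X_sub_C]
      simp
    rw [card_erase_of_mem (mem_range.2 hx), card_range] at h1
    exact degree_le_natDegree.trans_lt (by rw [h1]; exact Nat.cast_lt.2 (by omega))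
  have h0 : ∀ y ∈ range k, y ≠ x → f.eval (y : ℝ) = 0 := by
    intro y hy hyx
    rw [hf, eval_prod]
    exact prod_eq_zero (mem_erase.2 ⟨hyx, hy⟩) (by simp)
  have hne : f.eval (x : ℝ) ≠ 0 := by
    rw [hf, eval_prod, prod_ne_zero_iff]
    intro j hj
    have : (x : ℝ) ≠ j := by exact_mod_cast (mem_erase.1 hj).1.symm
    simpa [sub_eq_zero] using this
  have h1 := h f hd
  rw [pairing_apply, sum_eq_single x (fun y hy hyx => by rw [eval_mul, h0 y hy hyx]; ring)
    (fun hx' => absurd (mem_range.2 hx) hx'),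
    sum_eq_single x (fun y hy hyx => by rw [h0 y hy hyx]; ring)
    (fun hx' => absurd (mem_range.2 hx) hx'), eval_mul, ← mul_assoc] at h1
  exact mul_right_cancel₀ hne h1

/-- The `(n + 1)`-st difference of a polynomial of degree at most `n` is zero; the last term is
solved for. -/
lemma eval_eq_extrapolation {f : ℝ[X]} (hf : DegLT f (n + 1)) :
    f.eval ((n + 1 : ℕ) : ℝ) =
      ∑ x ∈ range (n + 1), (-1) ^ (n - x) * ((n + 1).choose x : ℝ) * f.eval (x : ℝ) := by
  have hd : f.natDegree < n + 1 := by
    rcases eq_or_ne f 0 with rfl | h0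
    · simp
    · exact (natDegree_lt_iff_degree_lt h0).2 hf
  have h := congrFun (Polynomial.fwdDiff_iter_eq_zero_of_degree_lt hd) 0
  rw [fwdDiff_iter_eq_sum_shift, sum_range_succ, Pi.zero_apply] at h
  simp only [zero_add, Nat.sub_self, pow_zero, Nat.choose_self, nsmul_eq_mul, mul_one] at h
  have h1 : ∀ x ∈ range (n + 1), (((-1 : ℤ) ^ (n + 1 - x) * ((n + 1).choose x : ℤ)) • f.eval (x : ℝ))
      = -((-1) ^ (n - x) * ((n + 1).choose x : ℝ) * f.eval (x : ℝ)) := by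
    intro x hx
    rw [Nat.succ_sub (Nat.lt_succ_iff.1 (mem_range.1 hx)), pow_succ, zsmul_eq_mul]
    push_cast
    ring
  rw [sum_congr rfl h1, sum_neg_distrib] at h
  simp at h
  push_cast
  linarith

lemma coeff_eq_difference {f : ℝ[X]} (hf : DegLT f (n + 1)) :
    f.coeff n = ∑ x ∈ range (n + 1),
      (-1) ^ (n - x) * (n.choose x : ℝ) / n.factorial * f.eval (x : ℝ) := by
  have hn : (n.factorial : ℝ) ≠ 0 := by exact_mod_cast n.factorial_ne_zero
  have h1 : (fwdDiff (1 : ℝ))^[n] f.eval 0 = f.coeff n * n.factorial := by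
    have hd := degree_sub_leading_lt hf
    have e : f.eval = (f - C (f.coeff n) * X ^ n).eval + (f.coeff n) • (fun x : ℝ => x ^ n) := by
      funext x
      simp
    have h0 : (fwdDiff (1 : ℝ))^[n] (f - C (f.coeff n) * X ^ n).eval = 0 := by
      rcases eq_or_ne (f - C (f.coeff n) * X ^ n) 0 with h | h
      · rw [h]
        have : (eval · (0 : ℝ[X])) = (0 : ℝ → ℝ) := by
          funext x
          simp
        rw [this]
        funext x
        rw [fwdDiff_iter_eq_sum_shift]
        simp
      · exact Polynomial.fwdDiff_iter_eq_zero_of_degree_lt ((natDegree_lt_iff_degree_lt h).2 hd)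
    rw [e, fwdDiff_iter_add, fwdDiff_iter_const_smul, h0, fwdDiff_iter_eq_factorial]
    simp
  rw [fwdDiff_iter_eq_sum_shift] at h1
  rw [← mul_div_cancel_right₀ (f.coeff n) hn, ← h1, sum_div]
  refine sum_congr rfl fun x _ => ?_
  rw [zsmul_eq_mul]
  push_cast
  simp only [zero_add, nsmul_eq_mul, mul_one]
  ring

lemma orthoPoly_self (hw : ∀ x < k, 0 < w x) : orthoPoly w k k = descPochhammer ℝ k := by
  symm
  refine eq_orthoPoly hw le_rfl (Krawtchouk.descPochhammer_sub_X_pow k) fun q _ => ?_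
  rw [pairing_apply]
  refine sum_eq_zero fun x hx => ?_
  rw [eval_mul, descPochhammer_eval_eq_descFactorial,
    Nat.descFactorial_eq_zero_iff_lt.2 (mem_range.1 hx)]
  simp

lemma pairing_orthoPoly_self (hw : ∀ x < k, 0 < w x) :
    pairing w k (orthoPoly w k k * orthoPoly w k k) = 0 := by
  rw [orthoPoly_self hw, pairing_apply]
  refine sum_eq_zero fun x hx => ?_
  rw [eval_mul, descPochhammer_eval_eq_descFactorial,
    Nat.descFactorial_eq_zero_iff_lt.2 (mem_range.1 hx)]
  simp

lemma leadDual_eval_self (hw : ∀ x < n + 1, 0 < w x) :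
    (leadDual w (n + 1) n).eval ((n + 1 : ℕ) : ℝ) =
      (∑ x ∈ range (n + 1), ((n + 1).choose x : ℝ) * (n.choose x) / w x) / n.factorial := by
  rw [eval_eq_extrapolation (degree_leadDual_lt w (n + 1) n), sum_div]
  refine sum_congr rfl fun x hx => ?_
  have hx' := mem_range.1 hx
  have h := eval_of_pairing (r := leadDual w (n + 1) n)
    (c := fun x => (-1) ^ (n - x) * (n.choose x : ℝ) / n.factorial)
    (fun f hf => (pairing_leadDual_mul hw le_rfl hf).trans (coeff_eq_difference hf)) hx'
  have h0 := (hw x hx').ne'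
  have h4 : ((-1 : ℝ) ^ (n - x)) * (-1) ^ (n - x) = 1 := by rw [← mul_pow]; norm_num
  rw [mul_comm, ← eq_div_iff h0] at h
  rw [h]
  field_simp
  linear_combination ((n + 1).choose x : ℝ) * (n.choose x : ℝ) * h4

/-- The summand `1` of `growth` becomes the term `x = n + 1`; the other terms come from
extrapolating the kernel to the next node. -/
lemma growth_self (hw : ∀ x < n + 2, 0 < w x) :
    growth w (n + 1) (n + 1) =
      w (n + 1) * ∑ x ∈ range (n + 2), ((n + 1).choose x : ℝ) * ((n + 1).choose x) / w x := by
  have hw' : ∀ x < n + 1, 0 < w x := fun x hx => hw x (by omega)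
  have h1 := (hw (n + 1) (by omega)).ne'
  rw [growth, eval_eq_extrapolation (degree_reproKernel_lt w (n + 1) (n + 1) _), sum_range_succ _ (n + 1),
    Nat.choose_self, mul_add, add_comm]
  congr 1
  · congr 1
    refine sum_congr rfl fun x hx => ?_
    have hx' := mem_range.1 hx
    have h := eval_of_pairing (r := reproKernel w (n + 1) (n + 1) ((n + 1 : ℕ) : ℝ))
      (c := fun x => (-1) ^ (n - x) * ((n + 1).choose x : ℝ))
      (fun f hf => (pairing_reproKernel_mul hw' le_rfl _ hf).trans (eval_eq_extrapolation hf)) hx'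
    have h0 := (hw' x hx').ne'
    have h4 : ((-1 : ℝ) ^ (n - x)) * (-1) ^ (n - x) = 1 := by rw [← mul_pow]; norm_num
    rw [mul_comm, ← eq_div_iff h0] at h
    rw [h]
    field_simp
    linear_combination ((n + 1).choose x : ℝ) ^ 2 * h4
  · field_simp
    simp

end TruncatedWeight

namespace Krawtchouk

variable {N n : ℕ} {p : ℝ}

lemma F_eq_sum (hp0 : 0 < p) (a b c : ℕ) :
    F (-(a : ℝ)) (-(b : ℝ)) (-(c : ℝ)) (1 - 1 / p) =
      ∑ j ∈ range (a + 1), (a.choose j : ℝ) * (b.choose j) / (c.choose j) *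
        ((1 - p) / p) ^ j := by
  rw [F, hypergeometric_eq_sum]
  refine sum_congr rfl fun j _ => ?_
  have hj : (j.factorial : ℝ) ≠ 0 := by exact_mod_cast j.factorial_ne_zero
  have hz : -(1 - 1 / p) = (1 - p) / p := by
    field_simp
    ring
  rw [hz, descPochhammer_eval_eq_descFactorial, Nat.descFactorial_eq_factorial_mul_choose,
    Nat.descFactorial_eq_factorial_mul_choose]
  push_cast
  rw [mul_left_comm, mul_div_mul_left _ _ hj]

lemma F_pos (hp0 : 0 < p) (hp1 : p < 1) (a b c : ℕ) :
    0 < F (-(a : ℝ)) (-(b : ℝ)) (-(c : ℝ)) (1 - 1 / p) := by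
  rw [F_eq_sum hp0, sum_range_succ']
  have h : 0 ≤ ∑ j ∈ range a, (a.choose (j + 1) : ℝ) * (b.choose (j + 1)) / (c.choose (j + 1)) *
      ((1 - p) / p) ^ (j + 1) := by
    refine sum_nonneg fun j _ => ?_
    positivity
  simp only [Nat.choose_zero_right]
  norm_num
  linarith

/-- Pascal's rule cancels the constant terms, and absorption `(n+1) C(n,j) = (j+1) C(n+1,j+1)`
handles the rest term by term. -/
lemma F_contiguous (hp0 : 0 < p) (n M : ℕ) (hnM : n ≤ M) :
    F (-((n + 1 : ℕ) : ℝ)) (-((n + 1 : ℕ) : ℝ)) (-((M + 1 : ℕ) : ℝ)) (1 - 1 / p) -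
      F (-((n + 1 : ℕ) : ℝ)) (-(n : ℝ)) (-((M + 1 : ℕ) : ℝ)) (1 - 1 / p) =
      (n + 1) / (M + 1) * ((1 - p) / p) * F (-(n : ℝ)) (-(n : ℝ)) (-(M : ℝ)) (1 - 1 / p) := by
  rw [F_eq_sum hp0, F_eq_sum hp0, F_eq_sum hp0, ← sum_sub_distrib, sum_range_succ', mul_sum]
  simp only [Nat.choose_zero_right, sub_self, add_zero]
  refine sum_congr rfl fun j hj => ?_
  have hjM : j ≤ M := (Nat.lt_succ_iff.1 (mem_range.1 hj)).trans hnM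
  have h1 : ((n : ℝ) + 1) * n.choose j = (n + 1).choose (j + 1) * (j + 1) := by
    exact_mod_cast Nat.add_one_mul_choose_eq n j
  have h2 : ((M : ℝ) + 1) * M.choose j = (M + 1).choose (j + 1) * (j + 1) := by
    exact_mod_cast Nat.add_one_mul_choose_eq M j
  have h3 : ((n + 1).choose (j + 1) : ℝ) = n.choose j + n.choose (j + 1) := by
    exact_mod_cast Nat.choose_succ_succ n j
  have h4 : (M.choose j : ℝ) ≠ 0 := by exact_mod_cast (Nat.choose_pos hjM).ne'
  have h5 : ((M + 1).choose (j + 1) : ℝ) ≠ 0 := by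
    exact_mod_cast (Nat.choose_pos (Nat.succ_le_succ hjM)).ne'
  have h6 : (n.choose (j + 1) : ℝ) = (n + 1).choose (j + 1) - n.choose j := by linarith
  have h7 : ((n + 1).choose (j + 1) : ℝ) / (M + 1).choose (j + 1) =
      (n + 1) / (M + 1) * (n.choose j / M.choose j) := by
    have hj1 : (j : ℝ) + 1 ≠ 0 := by positivity
    rw [div_mul_div_comm, div_eq_div_iff h5 (by positivity)]
    apply mul_right_cancel₀ hj1
    linear_combination ((n + 1).choose (j + 1) : ℝ) * (j + 1) * h2 -
      ((M + 1).choose (j + 1) : ℝ) * (j + 1) * h1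
  rw [h6, pow_succ]
  linear_combination (n.choose j : ℝ) * ((1 - p) / p) ^ j * ((1 - p) / p) * h7

lemma inv_weight (hp0 : 0 < p) (hp1 : p < 1) {x : ℕ} (hx : x ≤ N) :
    (weight N p x)⁻¹ = ((1 - p) ^ N)⁻¹ * ((N.choose x : ℝ)⁻¹ * ((1 - p) / p) ^ x) := by
  have hp : 0 < 1 - p := sub_pos.2 hp1
  have hc : (N.choose x : ℝ) ≠ 0 := by exact_mod_cast (Nat.choose_pos hx).ne'
  obtain ⟨d, rfl⟩ : ∃ d, N = x + d := ⟨N - x, by omega⟩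
  rw [weight, Nat.add_sub_cancel_left, pow_add, div_pow]
  field_simp

lemma sum_choose_div_weight (hp0 : 0 < p) (hp1 : p < 1) {a : ℕ} (b : ℕ) (ha : a ≤ N) :
    ∑ x ∈ range (a + 1), (a.choose x : ℝ) * (b.choose x) / weight N p x =
      ((1 - p) ^ N)⁻¹ * F (-(a : ℝ)) (-(b : ℝ)) (-(N : ℝ)) (1 - 1 / p) := by
  rw [F_eq_sum hp0, mul_sum]
  refine sum_congr rfl fun x hx => ?_
  rw [div_eq_mul_inv, inv_weight hp0 hp1 ((Nat.lt_succ_iff.1 (mem_range.1 hx)).trans ha)]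
  ring

section

variable (hp0 : 0 < p) (hp1 : p < 1)
include hp0 hp1

lemma alphaSeq_self (hn : n + 1 ≤ N) : alphaSeq N n p (n + 1) = (n + 1).factorial := by
  rw [alphaSeq, orthoPoly_self fun x hx => weight_pos hp0 hp1 (by omega),
    descPochhammer_eval_eq_descFactorial, Nat.descFactorial_self]

lemma betaSeq_self (hn : n + 1 ≤ N) : betaSeq N n p (n + 1) = ((1 - p) ^ N)⁻¹ *
    F (-((n + 1 : ℕ) : ℝ)) (-(n : ℝ)) (-(N : ℝ)) (1 - 1 / p) / n.factorial := by
  rw [betaSeq, leadDual_eval_self fun x hx => weight_pos hp0 hp1 (by omega),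
    ← sum_choose_div_weight hp0 hp1 n hn, sum_range_succ _ (n + 1), Nat.choose_succ_self]
  simp

lemma growth_krawtchouk_self (hn : n + 1 ≤ N) :
    growth (weight N p) (n + 1) (n + 1) = weight N p (n + 1) * (((1 - p) ^ N)⁻¹ *
      F (-((n + 1 : ℕ) : ℝ)) (-((n + 1 : ℕ) : ℝ)) (-(N : ℝ)) (1 - 1 / p)) := by
  rw [growth_self fun x hx => weight_pos hp0 hp1 (by omega), ← sum_choose_div_weight hp0 hp1 _ hn]

lemma D_self_succ (hn : n + 1 ≤ N) :
    D N (n + 1) p (n + 1 + 1) = (N.choose (n + 1) : ℝ) * p ^ (n + 1) *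
      (1 - p) ^ ((n + 1) * (N - (n + 1))) *
      F (-((n + 1 : ℕ) : ℝ)) (-((n + 1 : ℕ) : ℝ)) (-(N : ℝ)) (1 - 1 / p) := by
  have hp : 1 - p ≠ 0 := (sub_pos.2 hp1).ne'
  rw [D_succ hp0 hp1 hn le_rfl hn, D_self hp0 hp1 hn, growth_krawtchouk_self hp0 hp1 hn, weight]
  obtain ⟨d, rfl⟩ : ∃ d, N = n + 1 + d := ⟨N - (n + 1), by omega⟩
  rw [show n + 1 + d + 1 - (n + 1) = d + 1 by omega, Nat.add_sub_cancel_left]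
  have h : (1 - p) ^ ((n + 1) * (d + 1)) * (1 - p) ^ d =
      (1 - p) ^ ((n + 1) * d) * (1 - p) ^ (n + 1 + d) := by
    rw [← pow_add, ← pow_add]
    congr 1
    ring
  field_simp
  linear_combination h

/-- The orthogonal polynomial vanishes on all `k` nodes, so its norm at level `k` is zero and only
the rank-one increment survives in `bSeq`. -/
lemma eSeq_self_mul (hn : n + 1 ≤ N) :
    eSeq N n p (n + 1) * ((n + 1) - dropSeq N n p (n + 1)) =
      rate (weight N p) (n + 1) (n + 1) * alphaSeq N n p (n + 1) ^ 2 := by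
  have hw := weight_pos_of_lt hp0 hp1 hn
  have h1 := bSeq_eq hp0 hp1 le_rfl hn
  have h2 := pairing_orthoPoly_self (k := n + 1) fun x hx => hw x (by omega)
  rw [bSeq, pairing_orthoPoly_succ_self hw le_rfl, h2, ← alphaSeq] at h1
  linear_combination h1

lemma fSeq_self (hn : n + 1 ≤ N) : fSeq N n p (n + 1) = 0 := by
  have h := eSeq_self_mul hp0 hp1 hn
  have he := eSeq_pos hp0 hp1 le_rfl hn
  have hα := alphaSeq_pos hp0 hp1 le_rfl hn
  have hβ := betaSeq_pos hp0 hp1 le_rfl hn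
  have hg := gSeq_pos hp0 hp1 le_rfl hn
  have hT : dropSeq N n p (n + 1) = rate (weight N p) (n + 1) (n + 1) * alphaSeq N n p (n + 1) *
    betaSeq N n p (n + 1) := rfl
  have h1 : gSeq N n p (n + 1) * dropSeq N n p (n + 1) = n + 1 - dropSeq N n p (n + 1) := by
    apply mul_left_cancel₀ he.ne'
    rw [h]
    nth_rewrite 1 [hT]
    rw [gSeq]
    field_simp
  rw [fSeq, sub_eq_zero, div_eq_iff (by positivity)]
  push_cast
  linear_combination -h1

lemma eSeq_self (hn : n + 1 ≤ N) :
    eSeq N n p (n + 1) = N * p * (1 - p) ^ (N - 1) * (n.factorial : ℝ) ^ 2 /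
      F (-(n : ℝ)) (-(n : ℝ)) (-((N - 1 : ℕ) : ℝ)) (1 - 1 / p) := by
  have h := eSeq_self_mul hp0 hp1 hn
  have hw := weight_pos_of_lt hp0 hp1 hn
  have hρ := (growth_pos hw le_rfl).ne'
  have hp : 1 - p ≠ 0 := (sub_pos.2 hp1).ne'
  have hwk := (hw (n + 1) (by omega)).ne'
  have hf : (n.factorial : ℝ) ≠ 0 := by exact_mod_cast n.factorial_ne_zero
  obtain ⟨M, rfl⟩ : ∃ M, N = M + 1 := ⟨N - 1, by omega⟩
  have hc := F_contiguous hp0 n M (by omega)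
  have hF1 := (F_pos hp0 hp1 (n + 1) (n + 1) (M + 1)).ne'
  have hF3 := (F_pos hp0 hp1 n n M).ne'
  have hτ : rate (weight (M + 1) p) (n + 1) (n + 1) = (1 - p) ^ (M + 1) /
      F (-((n + 1 : ℕ) : ℝ)) (-((n + 1 : ℕ) : ℝ)) (-((M + 1 : ℕ) : ℝ)) (1 - 1 / p) := by
    rw [rate, growth_krawtchouk_self hp0 hp1 hn]
    field_simp
  rw [dropSeq, alphaSeq_self hp0 hp1 hn, betaSeq_self hp0 hp1 hn, hτ, Nat.factorial_succ] at h
  rw [Nat.add_sub_cancel]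
  set e := eSeq (M + 1) n p (n + 1)
  set F1 := F (-((n + 1 : ℕ) : ℝ)) (-((n + 1 : ℕ) : ℝ)) (-((M + 1 : ℕ) : ℝ)) (1 - 1 / p)
  set F2 := F (-((n + 1 : ℕ) : ℝ)) (-(n : ℝ)) (-((M + 1 : ℕ) : ℝ)) (1 - 1 / p)
  set F3 := F (-(n : ℝ)) (-(n : ℝ)) (-(M : ℝ)) (1 - 1 / p)
  have hM : (M : ℝ) + 1 ≠ 0 := by positivity
  have hn1 : (n : ℝ) + 1 ≠ 0 := by positivity
  -- Here `T = (n + 1) F2 / F1`, so `n + 1 - T` is proportional to `F1 - F2`, to which the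
  -- contiguous relation applies.
  have h1 : e * (F1 - F2) = (1 - p) ^ (M + 1) * ((n + 1) * (n.factorial : ℝ) ^ 2) := by
    push_cast at h
    field_simp at h
    linear_combination h
  rw [hc] at h1
  rw [eq_div_iff hF3]
  push_cast
  field_simp at h1
  rw [pow_succ] at h1
  apply mul_left_cancel₀ hp
  linear_combination h1

lemma gSeq_self (hn : n + 1 ≤ N) :
    gSeq N n p (n + 1) = (n + 1 : ℕ) * (1 - p) / (N * p) *
      (F (-(n : ℝ)) (-(n : ℝ)) (-((N - 1 : ℕ) : ℝ)) (1 - 1 / p) /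
        F (-((n + 1 : ℕ) : ℝ)) (-(n : ℝ)) (-(N : ℝ)) (1 - 1 / p)) := by
  have hp : 1 - p ≠ 0 := (sub_pos.2 hp1).ne'
  have hf : (n.factorial : ℝ) ≠ 0 := by exact_mod_cast n.factorial_ne_zero
  obtain ⟨M, rfl⟩ : ∃ M, N = M + 1 := ⟨N - 1, by omega⟩
  rw [gSeq, eSeq_self hp0 hp1 hn, alphaSeq_self hp0 hp1 hn, betaSeq_self hp0 hp1 hn,
    Nat.add_sub_cancel, Nat.factorial_succ, pow_succ (1 - p) M]
  push_cast
  field_simp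

end

end Krawtchouk

end

/-! ### Existence and uniqueness of the sequences; the determinant recurrence. -/

section

open Polynomial Finset TruncatedWeight

namespace Krawtchouk

variable {N n s : ℕ} {p : ℝ}

/-- The auxiliary ratio `α_{s+1} / (β_{s+1} e_s)`. -/
noncomputable def ratioSeq (N n : ℕ) (p : ℝ) (s : ℕ) : ℝ :=
  alphaSeq N n p (s + 1) / (betaSeq N n p (s + 1) * eSeq N n p s)

lemma one_add_ratio (hp1 : p < 1) (g : ℝ) : 1 + p / (p - 1) * g = (p - 1 + p * g) / (p - 1) := by
  have hp' : p - 1 ≠ 0 := by linarith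
  field_simp

section

variable (hp0 : 0 < p) (hp1 : p < 1)
include hp0 hp1

lemma fSeq_succ (hns : n + 1 ≤ s) (hs : s < N) :
    fSeq N n p (s + 1) = (s + 1) / (1 + ratioSeq N n p s) := by
  have h := (ladderStep hp0 hp1 hns hs).f_next
  rw [fSeq]
  push_cast
  exact h

/-- Each recurrence is an identity of `LadderStep` rewritten with `t = p / (p - 1)`; the sequence
`h` is `alphaSeq`. -/
lemma isSolution (hn : n + 1 ≤ N) :
    IsSolution N (n + 1) p (eSeq N n p) (fSeq N n p) (gSeq N n p) (alphaSeq N n p) := by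
  have hp' : p - 1 ≠ 0 := by linarith
  have hN1 : (1 : ℝ) - N = -((N - 1 : ℕ) : ℝ) := by
    rw [Nat.cast_sub (by omega)]
    push_cast
    ring
  have hk1 : (1 : ℝ) - (n + 1 : ℕ) = -(n : ℝ) := by
    push_cast
    ring
  constructor
  · rw [eSeq_self hp0 hp1 hn, hN1, hk1, Nat.add_sub_cancel]
  · exact fSeq_self hp0 hp1 hn
  · rw [gSeq_self hp0 hp1 hn, hN1, hk1]
  · exact alphaSeq_self hp0 hp1 hn
  · intro s hns hs
    have L := ladderStep hp0 hp1 hns hs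
    have h := L.e_step
    have ht : p * gSeq N n p s / (p - 1) = p / (p - 1) * gSeq N n p s := by ring
    have ht' : p * eSeq N n p s * gSeq N n p s / ((1 - p) * gSeq N n p (s + 1)) =
        -(p / (p - 1)) * eSeq N n p s * gSeq N n p s / gSeq N n p (s + 1) := by
      have := (gSeq_pos hp0 hp1 (show n + 1 ≤ s + 1 by omega) hs).ne'
      rw [← neg_sub p 1]
      field_simp
    rw [fSeq_succ hp0 hp1 hns hs, ht, ht']
    push_cast
    exact h
  · intro s hns hs
    have L := ladderStep hp0 hp1 hns hs
    have h := L.f_step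
    have h1 := L.one_add_pos.ne'
    have h2 : (1 - p) * ((N : ℝ) - s) / (p - 1 + p * gSeq N n p s) =
        ((s : ℝ) - N) / (1 + p / (p - 1) * gSeq N n p s) := by
      rw [one_add_ratio hp1] at h1 ⊢
      have h3 : p - 1 + p * gSeq N n p s ≠ 0 := (div_ne_zero_iff.1 h1).1
      field_simp
      ring
    rw [fSeq_succ hp0 hp1 hns hs, h2, fSeq, ratioSeq, h]
    push_cast
    ring
  · intro s hns hs
    have L := ladderStep hp0 hp1 hns hs
    have h := L.g_step
    have hg := (gSeq_pos hp0 hp1 hns hs.le).ne'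
    rw [fSeq_succ hp0 hp1 hns hs]
    apply mul_left_cancel₀ hg
    rw [h, ← ratioSeq]
    push_cast
    set f := ((s : ℝ) + 1) / (1 + ratioSeq N n p s)
    rw [← neg_sub p 1, ← neg_sub f ((N : ℝ) + 1 - (n + 1))]
    field_simp
  · intro s hns hs
    have L := ladderStep hp0 hp1 hns hs
    have h := L.h_step
    have hg := (gSeq_pos hp0 hp1 hns hs.le).ne'
    have he := (eSeq_pos hp0 hp1 hns hs.le).ne'
    have hα := alphaSeq_pos hp0 hp1 hns hs.le
    have hβ := betaSeq_pos hp0 hp1 hns hs.le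
    have hβ' := betaSeq_pos hp0 hp1 (show n + 1 ≤ s + 1 by omega) hs
    have hNs : (N : ℝ) - s ≠ 0 := (sub_pos.2 L.hsN).ne'
    have hα' : alphaSeq N n p (s + 1) =
        ratioSeq N n p s * (betaSeq N n p (s + 1) * eSeq N n p s) := by
      rw [ratioSeq]
      field_simp
    have hα2 : alphaSeq N n p s = gSeq N n p s * (betaSeq N n p s * eSeq N n p s) := by
      rw [gSeq]
      field_simp
    rw [← ratioSeq, one_add_ratio hp1] at h
    rw [fSeq_succ hp0 hp1 hns hs, hα2, hα']
    nth_rewrite 1 [h]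
    field_simp

end

/-- Each step computes `f`, then `g`, then `e` and `h` from known values. Division being total, no
nonvanishing is needed, so nonvanishing itself can be transferred from the explicit solution. -/
lemma IsSolution.unique {k : ℕ} {e f g h e' f' g' h' : ℕ → ℝ} (H : IsSolution N k p e f g h)
    (H' : IsSolution N k p e' f' g' h') :
    ∀ s, k ≤ s → s ≤ N → e s = e' s ∧ f s = f' s ∧ g s = g' s ∧ h s = h' s := by
  intro s hs
  induction s, hs using Nat.le_induction with
  | base =>
    intro _
    exact ⟨H.e_init.trans H'.e_init.symm, H.f_init.trans H'.f_init.symm,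
      H.g_init.trans H'.g_init.symm, H.h_init.trans H'.h_init.symm⟩
  | succ s hs ih =>
    intro hsN
    obtain ⟨he, hf, hg, hh⟩ := ih (by omega)
    have hf1 : f (s + 1) = f' (s + 1) := by
      rw [H.f_step s hs hsN, H'.f_step s hs hsN, hf, hg]
    have hg1 : g (s + 1) = g' (s + 1) := by
      rw [H.g_step s hs hsN, H'.g_step s hs hsN, hf1, hg]
    refine ⟨?_, hf1, hg1, ?_⟩
    · rw [H.e_step s hs hsN, H'.e_step s hs hsN, he, hf1, hg, hg1]
    · rw [H.h_step s hs hsN, H'.h_step s hs hsN, hf1, hg, hh]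

section

variable (hp0 : 0 < p) (hp1 : p < 1)
include hp0 hp1

/-- The ladder for `orthoPoly` at `x = s + 1` is compared at levels `s` and `s + 1`; at the latter
every value is an `α` or `β` divided by a `growth`. In the difference the terms containing the rate
of level `s + 1` cancel. -/
lemma growth_succ_sub (hns : n + 1 ≤ s) (hs : s < N) :
    ((s : ℝ) + 1) * (growth (weight N p) (s + 1) (n + 1) - growth (weight N p) s (n + 1)) =
      -(weight N p s) * (betaSeq N n p s * alphaSeq N n p (s + 1) -
        p / (p - 1) * alphaSeq N n p s * betaSeq N n p (s + 1)) := by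
  have hw := weight_pos_of_lt hp0 hp1 hs.le
  have hw' := weight_pos_of_lt hp0 hp1 (Nat.succ_le_of_lt hs)
  have hρ := (growth_pos hw hns).ne'
  have hρ' := (growth_pos hw' (show n + 1 ≤ s + 1 by omega)).ne'
  have hα := (alphaSeq_pos hp0 hp1 hns hs.le).ne'
  have ht : p / (1 - p) = -(p / (p - 1)) := by
    rw [← neg_sub, div_neg]
  have l1 := eval_orthoPoly_ladder hp0 hp1 hns hs.le (s + 1)
  have l2 := eval_orthoPoly_ladder hp0 hp1 (show n + 1 ≤ s + 1 by omega) hs (s + 1)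
  have e1 := eval_orthoPoly_succ_self hw hns
  have e2 := eval_orthoPoly_succ_self hw' (show n + 1 ≤ s + 1 by omega)
  have e3 := eval_leadDual_succ_self (n := n) hw' (by omega)
  rw [← alphaSeq] at e1 e2
  rw [← betaSeq] at e3
  push_cast at e2 e3
  rw [add_sub_cancel_right] at l1 l2
  rw [e1, e2, e3] at l2
  have l1' : ((s : ℝ) + 1) * alphaSeq N n p s = (s + 1 + (dropSeq N n p s - (n + 1))) *
      alphaSeq N n p (s + 1) + bSeq N n p s * betaSeq N n p (s + 1) := by
    simpa [alphaSeq, betaSeq] using l1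
  have hb := bSeq_succ hp0 hp1 hns hs
  have hT : dropSeq N n p s =
    rate (weight N p) s (n + 1) * alphaSeq N n p s * betaSeq N n p s := rfl
  have hT' : dropSeq N n p (s + 1) = rate (weight N p) (s + 1) (n + 1) *
    alphaSeq N n p (s + 1) * betaSeq N n p (s + 1) := rfl
  have hr : rate (weight N p) s (n + 1) * growth (weight N p) s (n + 1) = weight N p s :=
    div_mul_cancel₀ _ hρ
  rw [ht] at hb
  rw [hb, hT'] at l2
  rw [hT] at l1'
  field_simp at l2
  set t := p / (p - 1)
  apply mul_left_cancel₀ hα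
  rw [← hr]
  linear_combination l2 - growth (weight N p) s (n + 1) * l1'

lemma D_recurrence (hn : n + 1 ≤ N) (hns : n + 1 ≤ s) (hs : s < N) :
    D N (n + 1) p (s + 2) / D N (n + 1) p (s + 1) - D N (n + 1) p (s + 1) / D N (n + 1) p s =
      (N.choose (s + 1) : ℝ) * (p ^ (s - 1) * (1 - p) ^ (N - s + 1) / ((N : ℝ) - s) ^ 2) *
        ((1 + p * gSeq N n p s / (p - 1)) / (eSeq N n p s * gSeq N n p s ^ 2)) *
        ((1 + p * gSeq N n p s / (p - 1)) * fSeq N n p (s + 1) - s - 1) *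
          alphaSeq N n p s ^ 2 := by
  have hp : 0 < 1 - p := sub_pos.2 hp1
  have h0 := D_ne_zero hp0 hp1 hn hns (by omega)
  have h1 := D_ne_zero hp0 hp1 hn (show n + 1 ≤ s + 1 by omega) (by omega)
  have L := ladderStep hp0 hp1 hns hs
  have hd := L.det_factor
  have hρ := growth_succ_sub hp0 hp1 hns hs
  have hg := (gSeq_pos hp0 hp1 hns hs.le).ne'
  have he := (eSeq_pos hp0 hp1 hns hs.le).ne'
  have hβ := betaSeq_pos hp0 hp1 hns hs.le
  have hβ' := betaSeq_pos hp0 hp1 (show n + 1 ≤ s + 1 by omega) hs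
  have hNs : (N : ℝ) - s ≠ 0 := (sub_pos.2 L.hsN).ne'
  have hα' : alphaSeq N n p (s + 1) =
      ratioSeq N n p s * (betaSeq N n p (s + 1) * eSeq N n p s) := by
    rw [ratioSeq]
    field_simp
  have hα2 : alphaSeq N n p s = gSeq N n p s * (betaSeq N n p s * eSeq N n p s) := by
    rw [gSeq]
    field_simp
  have hL : D N (n + 1) p (s + 2) / D N (n + 1) p (s + 1) -
      D N (n + 1) p (s + 1) / D N (n + 1) p s =
      growth (weight N p) (s + 1) (n + 1) - growth (weight N p) s (n + 1) := by
    rw [D_succ hp0 hp1 hn (show n + 1 ≤ s + 1 by omega) hs, mul_div_cancel_left₀ _ h1,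
      D_succ hp0 hp1 hn hns hs.le, mul_div_cancel_left₀ _ h0]
  have hs1 : (s : ℝ) + 1 ≠ 0 := by positivity
  rw [hL, fSeq_succ hp0 hp1 hns hs]
  apply mul_left_cancel₀ hs1
  rw [hρ, hα', hα2]
  have ht : p * gSeq N n p s / (p - 1) = p / (p - 1) * gSeq N n p s := by ring
  have htp : p = -(p / (p - 1)) * (1 - p) := by
    have hp' : p - 1 ≠ 0 := by linarith
    field_simp
    ring
  -- Moves the binomial coefficient to index `s + 1`, the one in the statement; together with `htp`
  -- this also accounts for the exponents of `p` and `1 - p`.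
  have hw : weight N p s * (N - s) =
      (s + 1) * N.choose (s + 1) * p ^ s * (1 - p) ^ (N - s) := by
    have hc : (N.choose (s + 1) : ℝ) * (s + 1) = N.choose s * ((N - s : ℕ) : ℝ) := by
      exact_mod_cast Nat.choose_succ_right_eq N s
    rw [Nat.cast_sub hs.le] at hc
    rw [weight]
    linear_combination -(p ^ s * (1 - p) ^ (N - s)) * hc
  have hps : p ^ s = p ^ (s - 1) * p := by
    rw [← pow_succ]
    congr 1
    omega
  rw [ht, pow_succ (1 - p)]
  rw [← ratioSeq] at hd
  rw [hps] at hw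
  set t := p / (p - 1)
  set W := ratioSeq N n p s
  set g := gSeq N n p s
  set e := eSeq N n p s
  set b := betaSeq N n p s
  set b' := betaSeq N n p (s + 1)
  set G := (1 + t * g) * ((s + 1) / (1 + W)) - s - 1
  have hd' : (1 + t * g) * G * b = -t * (N - s) * (t * g - W) * b' := by
    rw [← hd]
    field_simp
  have hw' : weight N p s = (s + 1) * N.choose (s + 1) * (p ^ (s - 1) * (-t * (1 - p))) *
      (1 - p) ^ (N - s) / (N - s) := by
    rw [eq_div_iff hNs, hw, ← htp]
  rw [hw']
  field_simp
  linear_combination -(N.choose (s + 1) : ℝ) * hd'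

end

end Krawtchouk

end

theorem theorem11p4 (N k : ℕ) (hk : 1 ≤ k) (hkN : k ≤ N) (p : ℝ) (hp0 : 0 < p) (hp1 : p < 1) :
    -- the determinants are nonzero and are the gap probabilities
    (∀ s, k ≤ s → s ≤ N + 1 →
      Krawtchouk.D N k p s ≠ 0 ∧ Krawtchouk.D N k p s = Krawtchouk.gapProb N k p s) ∧
    -- initial conditions for the determinants
    Krawtchouk.D N k p k = (1 - p) ^ (k * (N + 1 - k)) ∧
    Krawtchouk.D N k p (k + 1) = (N.choose k : ℝ) * p ^ k * (1 - p) ^ (k * (N - k)) *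
      Krawtchouk.F (-k) (-k) (-N) (1 - 1 / p) ∧
    -- the initial values of the sequences are well defined, and the sequences exist
    Krawtchouk.F (1 - k) (1 - k) (1 - N) (1 - 1 / p) ≠ 0 ∧
    Krawtchouk.F (-k) (1 - k) (-N) (1 - 1 / p) ≠ 0 ∧
    (∃ e f g h : ℕ → ℝ, Krawtchouk.IsSolution N k p e f g h) ∧
    ∀ e f g h : ℕ → ℝ, Krawtchouk.IsSolution N k p e f g h →
      -- no denominator in the recurrences vanishes
      (∀ s, k ≤ s → s ≤ N → e s ≠ 0 ∧ g s ≠ 0) ∧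
      (∀ s, k ≤ s → s < N →
        1 + g s ≠ 0 ∧ p - 1 + p * g s ≠ 0 ∧ f (s + 1) ≠ 0 ∧ (N : ℝ) + 1 - k - f (s + 1) ≠ 0 ∧
        (1 + p * g s / (p - 1)) * f (s + 1) + k - s - 1 ≠ 0) ∧
      -- the recurrence for the determinants
      (∀ s, k ≤ s → s < N →
        Krawtchouk.D N k p (s + 2) / Krawtchouk.D N k p (s + 1) -
            Krawtchouk.D N k p (s + 1) / Krawtchouk.D N k p s =
          (N.choose (s + 1) : ℝ) * (p ^ (s - 1) * (1 - p) ^ (N - s + 1) / ((N : ℝ) - s) ^ 2) *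
            ((1 + p * g s / (p - 1)) / (e s * g s ^ 2)) *
            ((1 + p * g s / (p - 1)) * f (s + 1) - s - 1) * h s ^ 2) ∧
      -- the pair `(f, g)` evolves by d-P_V
      (∀ s, k ≤ s → s < N →
        (Krawtchouk.dpvParams N k p s).lam = 1 ∧
        Krawtchouk.dpvParams N k p (s + 1) = (Krawtchouk.dpvParams N k p s).shift ∧
        (Krawtchouk.dpvParams N k p s).IsStep (f s) (g s) (f (s + 1)) (g (s + 1))) := by
  obtain ⟨n, rfl⟩ : ∃ n, k = n + 1 := ⟨k - 1, by omega⟩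
  have hk1 : (1 : ℝ) - (n + 1 : ℕ) = -(n : ℝ) := by
    push_cast
    ring
  have hN1 : (1 : ℝ) - N = -((N - 1 : ℕ) : ℝ) := by
    rw [Nat.cast_sub (by omega)]
    push_cast
    ring
  have hsol := Krawtchouk.isSolution hp0 hp1 hkN
  refine ⟨fun s hns hs => ⟨Krawtchouk.D_ne_zero hp0 hp1 hkN hns hs, ?_⟩,
    Krawtchouk.D_self hp0 hp1 hkN, Krawtchouk.D_self_succ hp0 hp1 hkN, ?_, ?_,
    ⟨_, _, _, _, hsol⟩, fun e f g h H => ?_⟩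
  · rw [Krawtchouk.D_eq_div hp0 hp1 hkN hs, Krawtchouk.gapProb_eq_div _ hs]
  · rw [hk1, hN1]
    exact (Krawtchouk.F_pos hp0 hp1 _ _ _).ne'
  · rw [hk1]
    exact (Krawtchouk.F_pos hp0 hp1 _ _ _).ne'
  -- From here on an arbitrary solution is replaced on `k ≤ s ≤ N` by the explicit one, whose
  -- positivity is known.
  have hu := H.unique hsol
  have hl : ∀ s, (Krawtchouk.dpvParams N (n + 1) p s).lam = 1 := by
    intro s
    simp only [DPVParams.lam, Krawtchouk.dpvParams]
    push_cast
    ring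
  have hstep : ∀ s, n + 1 ≤ s → s < N →
      1 + g s ≠ 0 ∧ p - 1 + p * g s ≠ 0 ∧ f (s + 1) ≠ 0 ∧
        (N : ℝ) + 1 - (n + 1 : ℕ) - f (s + 1) ≠ 0 ∧
        (1 + p * g s / (p - 1)) * f (s + 1) + (n + 1 : ℕ) - s - 1 ≠ 0 := by
    intro s hns hs
    have L := Krawtchouk.ladderStep hp0 hp1 hns hs
    rw [(hu s hns hs.le).2.2.1, (hu (s + 1) (by omega) hs).2.1,
      Krawtchouk.fSeq_succ hp0 hp1 hns hs]
    have hg := Krawtchouk.gSeq_pos hp0 hp1 hns hs.le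
    have h1 := L.one_add_pos.ne'
    have hw : 0 < 1 + Krawtchouk.ratioSeq N n p s := by
      have hw0 : 0 < Krawtchouk.ratioSeq N n p s := L.hw
      linarith
    refine ⟨by positivity, ?_, by positivity, ?_, ?_⟩
    · rw [Krawtchouk.one_add_ratio hp1] at h1
      exact (div_ne_zero_iff.1 h1).1
    · have h2 := L.sub_f_ne_zero
      rw [← Krawtchouk.ratioSeq] at h2
      intro h3
      apply h2
      push_cast at h3
      field_simp at h3
      linarith
    · have h2 := L.e_den_ne_zero
      rw [mul_div_right_comm]
      push_cast
      exact h2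
  refine ⟨fun s hns hs => ?_, hstep, fun s hns hs => ?_, fun s hns hs => ⟨?_, ?_, ?_⟩⟩
  · rw [(hu s hns hs).1, (hu s hns hs).2.2.1]
    exact ⟨(Krawtchouk.eSeq_pos hp0 hp1 hns hs).ne', (Krawtchouk.gSeq_pos hp0 hp1 hns hs).ne'⟩
  · obtain ⟨h1, -, h3, h4⟩ := hu s hns hs.le
    rw [h1, h3, h4, (hu (s + 1) (by omega) hs).2.1]
    exact Krawtchouk.D_recurrence hp0 hp1 hkN hns hs
  · exact hl s
  · ext <;> simp only [DPVParams.shift, hl] <;> simp only [Krawtchouk.dpvParams] <;> push_cast <;>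
      ring
  · obtain ⟨h1, h2, h3, h4, -⟩ := hstep s hns hs
    have hp' : p - 1 ≠ 0 := by linarith
    have L := Krawtchouk.ladderStep hp0 hp1 hns hs
    refine ⟨h1, ?_, div_ne_zero hp0.ne' hp', h3, ?_, ?_, ?_⟩
    · exact (Krawtchouk.one_add_ratio hp1 (g s)).trans_ne (div_ne_zero h2 hp')
    · rw [← neg_sub]
      exact neg_ne_zero.2 h4
    · rw [H.f_step s hns hs]
      simp only [Krawtchouk.dpvParams]
      rw [Krawtchouk.one_add_ratio hp1]
      field_simp
      ring
    · rw [hl, (hu s hns hs.le).2.2.1, (hu (s + 1) (by omega) hs).2.1,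
        (hu (s + 1) (by omega) hs).2.2.1, Krawtchouk.fSeq_succ hp0 hp1 hns hs, L.g_step,
        ← Krawtchouk.ratioSeq]
      simp only [Krawtchouk.dpvParams]
      push_cast
      congr 1
      ring
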